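/- Let $\mathcal T=(\mathcal V,\mathcal E)$ be a finite tree with set of leaves $\mathcal L$ (the vertices of degree one), and root it at a leaf $r\in\mathcal L$. Let $\mathcal E_r$ be the set of edges directed away from $r$. Let $\mu_j\in\mathbb R_+^n$, $j\in\mathcal L$, be given nonnegative vectors of equal total mass. For $(j,k)\in\mathcal E_r$ let $A^{(j,k)}\in\mathbb R^{n\times n}$ be a row-stochastic matrix with strictly positive entries. Let $\epsilon>0$ and let $C^{(j,k)}$ be matrices such that $$K^{(j,k)}:=\exp\bigl(-C^{(j,k)}/\epsilon\bigr)=A^{(j,k)}\quad\text{for all }(j,k)\in\mathcal E_r ,$$ where $\exp$ is elementwise. Below, $\odot$ and $./$ denote elementwise multiplication and division, $\mathbf 1$ is the vector of ones, and $H(p\,|\,q)=\sum_i\bigl(p_i\log(p_i/q_i)-p_i+q_i\bigr)$ with $0\log 0=0$. For a tensor $\mathbf M=(\mathbf M_x)_{x\in\{1,\dots,n\}^{\mathcal V}}$, $P_j(\mathbf M)$ and $P_{(j,k)}(\mathbf M)$ denote its marginal at $j$ and its bi-marginal at $(j,k)$, obtained by summing over all other indices. Consider the following two problems. (OT) Minimize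 $\langle \mathbf C,\mathbf M\rangle+\epsilon H(\mathbf M\,|\,\mathbf 1)$ over nonnegative tensors $\mathbf M$ with $P_j(\mathbf M)=\mu_j$ for $j\in\mathcal L$, where $\mathbf C_x=\sum_{(j,k)\in\mathcal E_r}C^{(j,k)}_{x_j,x_k}$. (SB) Minimize $\sum_{(j,k)\in\mathcal E_r}H\bigl(M^{(j,k)}\,\big|\,\mathrm{diag}(\mu_j)A^{(j,k)}\bigr)$ over nonnegative matrices $M^{(j,k)}$, $(j,k)\in\mathcal E_r$, and vectors $\mu_j$, $j\in\mathcal V\setminus\mathcal L$, subject to $M^{(j,k)}\mathbf 1=\mu_j$ and $(M^{(j,k)})^T\mathbf 1=\mu_k$ for $(j,k)\in\mathcal E_r$. Then: 1. Each problem has exactly one solution. If $\mathbf M$ is the solution of (OT), and $(\mu_j)_{j\in\mathcal V}$, $(M^{(j,k)})_{(j,k)\in\mathcal E_r}$ is the solution of (SB), then $P_j(\mathbf M)=\mu_j$ for all $j\in\mathcal V$ and $P_{(j,k)}(\mathbf M)=M^{(j,k)}$ for all $(j,k)\in\mathcal E_r$. 2. Call strictly positive vectors $u_j$, $j\in\mathcal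 V$, with $u_j=\mathbf 1$ for $j\notin\mathcal L$, scaling vectors of $\mathbf M$ if $\mathbf M=\mathbf K\odot\mathbf U$, where $\mathbf K=\exp(-\mathbf C/\epsilon)$ and $\mathbf U=\bigotimes_{j\in\mathcal V}u_j$. If all entries of the given vectors $\mu_j$, $j\in\mathcal L$, are positive, then the solution $\mathbf M$ of (OT) has scaling vectors. 3. Say that strictly positive vectors $v_j$, $j\in\mathcal L$, represent the solution of (SB) if $$\mu_j=\varphi_j\odot\hat\varphi_j\ (j\in\mathcal V),\qquad M^{(j,k)}=\mathrm{diag}(\hat\varphi_j\odot\varphi_{j\setminus k})\,A^{(j,k)}\,\mathrm{diag}(\varphi_k)\ \ ((j,k)\in\mathcal E_r),$$ where $\varphi_j=v_j$ for $j\in\mathcal L\setminus\{r\}$ and $\varphi_j=\bigodot_{k:(j,k)\in\mathcal E_r}A^{(j,k)}\varphi_k$ otherwise, $\varphi_{j\setminus k}=\varphi_j./(A^{(j,k)}\varphi_k)$, $\hat\varphi_r=\mathbf 1./v_r$, and $\hat\varphi_k=(A^{(j,k)})^T(\hat\varphi_j\odot\varphi_{j\setminus k})$ for $(j,k)\in\mathcal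 E_r$. Then strictly positive vectors $v_j$, $j\in\mathcal L$, represent the solution of (SB) if and only if $$u_r=\mathbf 1./v_r,\qquad u_j=v_j\ (j\in\mathcal L\setminus\{r\}),\qquad u_j=\mathbf 1\ (j\notin\mathcal L)$$ are scaling vectors of $\mathbf M$. Moreover, if $v$ represents the solution of (SB), then every family of scaling vectors $u$ of $\mathbf M$ is of this form up to constants: there are $c_j>0$, $j\in\mathcal L$, with $\prod_{j\in\mathcal L}c_j=1$, $u_r=c_r\,(\mathbf 1./v_r)$ and $u_j=c_jv_j$ for $j\in\mathcal L\setminus\{r\}$. -/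

import Mathlib

open Finset

namespace TreeOT

/-- Real tensors with one mode per vertex, each mode of size `n`. -/
abbrev Tensor (V : Type*) (n : ℕ) : Type _ := (V → Fin n) → ℝ

/-! ### Rooted trees -/

section Trees

variable {V : Type*} [Fintype V] [DecidableEq V]

/-- The leaves of a graph: the vertices of degree one. -/
def leaves (G : SimpleGraph V) [DecidableRel G.Adj] : Finset V :=
  univ.filter fun j => G.degree j = 1

/-- `k < j` in the order defined by the root `r`: `k ≠ j` lies on the path between `r` and `j`. -/
def Precedes (G : SimpleGraph V) (r k j : V) : Prop :=
  k ≠ j ∧ ∃ p : G.Walk r j, p.IsPath ∧ k ∈ p.support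

open Classical in
/-- The edges of `G`, each taken once, directed away from the root `r`. -/
noncomputable def rootedEdges (G : SimpleGraph V) (r : V) : Finset (V × V) :=
  univ.filter fun e => G.Adj e.1 e.2 ∧ Precedes G r e.1 e.2

/-- The children of the vertex `j`. -/
noncomputable def children (G : SimpleGraph V) (r j : V) : Finset V :=
  univ.filter fun k => (j, k) ∈ rootedEdges G r

end Trees

/-! ### Relative entropy and marginals -/

/-- The normalized Kullback-Leibler divergence
`H(p | q) = ∑ i, (p i * log (p i / q i) - p i + q i)` of nonnegative arrays, with `0 log 0 = 0`.
It is only evaluated below where `q i = 0` implies `p i = 0`, so that the value is finite. -/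
noncomputable def relEntropy {ι : Type*} [Fintype ι] (p q : ι → ℝ) : ℝ :=
  ∑ i, (p i * Real.log (p i / q i) - p i + q i)

/-- The divergence of two matrices. -/
noncomputable def matRelEntropy {n : ℕ} (M Q : Matrix (Fin n) (Fin n) ℝ) : ℝ :=
  relEntropy (fun x : Fin n × Fin n => M x.1 x.2) (fun x : Fin n × Fin n => Q x.1 x.2)

section Problems

variable {V : Type*} [Fintype V] [DecidableEq V] {n : ℕ}

/-- The projection on the `j`-th marginal. -/
def marginal (M : Tensor V n) (j : V) : Fin n → ℝ :=
  fun a => ∑ x with x j = a, M x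

/-- The projection on the pair of marginals `j`, `k`. -/
def bimarginal (M : Tensor V n) (j k : V) : Matrix (Fin n) (Fin n) ℝ :=
  Matrix.of fun a b => ∑ x with x j = a ∧ x k = b, M x

/-! ### Entropy regularized multi-marginal optimal transport -/

/-- Nonnegative tensors whose marginals indexed by `Γ` are the prescribed ones. -/
def OTFeasible (Γ : Finset V) (μ : V → Fin n → ℝ) (M : Tensor V n) : Prop :=
  (∀ x, 0 ≤ M x) ∧ ∀ j ∈ Γ, marginal M j = μ j

/-- The objective `⟨C, M⟩ + ε H(M)`, where `H(M) = H(M | 1)`. -/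
noncomputable def otObjective (ε : ℝ) (C M : Tensor V n) : ℝ :=
  ∑ x, C x * M x + ε * relEntropy M (fun _ => 1)

/-- `M` minimizes `⟨C, M⟩ + ε H(M)` subject to the constraints on the marginals in `Γ`. -/
def IsOTSolution (ε : ℝ) (C : Tensor V n) (Γ : Finset V) (μ : V → Fin n → ℝ)
    (M : Tensor V n) : Prop :=
  OTFeasible Γ μ M ∧ ∀ M' : Tensor V n, OTFeasible Γ μ M' → otObjective ε C M ≤ otObjective ε C M'

/-- The cost tensor that decouples along the edges of the tree. Every undirected edge contributes
once; with the convention that the cost matrix of a reversed edge is the transpose, the choice of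
directions does not matter. -/
noncomputable def treeCost (G : SimpleGraph V) (r : V)
    (C : V → V → Matrix (Fin n) (Fin n) ℝ) : Tensor V n :=
  fun x => ∑ e ∈ rootedEdges G r, C e.1 e.2 (x e.1) (x e.2)

/-- The tensor `K = exp (-C / ε)`. -/
noncomputable def gibbs (ε : ℝ) (C : Tensor V n) : Tensor V n :=
  fun x => Real.exp (-C x / ε)

/-- The rank one tensor `U = u_1 ⊗ ⋯ ⊗ u_J`. -/
def outer (u : V → Fin n → ℝ) : Tensor V n :=
  fun x => ∏ j, u j (x j)

/-- `u` is a family of scaling vectors of the tensor `M`, for constraints on `Γ`: the vectors are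
strictly positive, those outside `Γ` are the vector of ones, and `M = K ⊙ (u_1 ⊗ ⋯ ⊗ u_J)`. -/
def IsScaling (K : Tensor V n) (Γ : Finset V) (M : Tensor V n) (u : V → Fin n → ℝ) : Prop :=
  (∀ j i, 0 < u j i) ∧ (∀ j, j ∉ Γ → u j = 1) ∧ M = K * outer u

/-! ### The tree-structured Schrödinger bridge problem -/

variable (G : SimpleGraph V) [DecidableRel G.Adj] (r : V)

/-- The constraints: `P j k` is a nonnegative matrix with marginals `ν j` and `ν k` for every
directed edge `(j, k)`, and `ν` agrees with the given marginals `μ` on the leaves. -/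
def SBFeasible (μ ν : V → Fin n → ℝ) (P : V → V → Matrix (Fin n) (Fin n) ℝ) : Prop :=
  (∀ j ∈ leaves G, ν j = μ j) ∧
  ∀ e ∈ rootedEdges G r, (∀ a b, 0 ≤ P e.1 e.2 a b) ∧
    Matrix.mulVec (P e.1 e.2) 1 = ν e.1 ∧ Matrix.mulVec (P e.1 e.2).transpose 1 = ν e.2

/-- The objective `∑ H(P^(j,k) | diag(ν_j) A^(j,k))`, summed over the directed edges. -/
noncomputable def sbObjective (A : V → V → Matrix (Fin n) (Fin n) ℝ)
    (ν : V → Fin n → ℝ) (P : V → V → Matrix (Fin n) (Fin n) ℝ) : ℝ :=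
  ∑ e ∈ rootedEdges G r, matRelEntropy (P e.1 e.2) (Matrix.diagonal (ν e.1) * A e.1 e.2)

/-- `(ν, P)` solves the Schrödinger bridge problem with given marginals `μ` on the leaves. The
entries of `P` off the directed edges play no role. -/
def IsSBSolution (A : V → V → Matrix (Fin n) (Fin n) ℝ) (μ ν : V → Fin n → ℝ)
    (P : V → V → Matrix (Fin n) (Fin n) ℝ) : Prop :=
  SBFeasible G r μ ν P ∧
  ∀ ν' P', SBFeasible G r μ ν' P' → sbObjective G r A ν P ≤ sbObjective G r A ν' P'

/-- `φ_{j \ k} = φ_j ./ (A^(j,k) φ_k)`. -/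
noncomputable def phiWithout (A : V → V → Matrix (Fin n) (Fin n) ℝ) (φ : V → Fin n → ℝ)
    (j k : V) : Fin n → ℝ :=
  φ j / Matrix.mulVec (A j k) (φ k)

/-- The strictly positive leaf vectors `v` represent `(ν, P)`. The backward factors `φ` equal `v`
on the leaves other than the root and satisfy `φ_j = ⨀ A^(j,k) φ_k` (product over the children `k`
of `j`) elsewhere; the forward factors are given by `ψ_r = 1 ./ v_r` and
`ψ_k = (A^(j,k))ᵀ (ψ_j ⊙ φ_{j \ k})` for the edge `(j, k)` into `k`; and
`ν_j = φ_j ⊙ ψ_j`, `P^(j,k) = diag(ψ_j ⊙ φ_{j \ k}) A^(j,k) diag(φ_k)`. -/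
def IsSBFactorization (A : V → V → Matrix (Fin n) (Fin n) ℝ) (ν : V → Fin n → ℝ)
    (P : V → V → Matrix (Fin n) (Fin n) ℝ) (v : V → Fin n → ℝ) : Prop :=
  (∀ j ∈ leaves G, ∀ i, 0 < v j i) ∧
  ∃ φ ψ : V → Fin n → ℝ,
    (∀ j ∈ leaves G, j ≠ r → φ j = v j) ∧
    (∀ j, j ∉ leaves G ∨ j = r → φ j = ∏ k ∈ children G r j, Matrix.mulVec (A j k) (φ k)) ∧
    ψ r = 1 / v r ∧
    (∀ e ∈ rootedEdges G r,
      ψ e.2 = Matrix.mulVec (A e.1 e.2).transpose (ψ e.1 * phiWithout A φ e.1 e.2)) ∧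
    (∀ j, ν j = φ j * ψ j) ∧
    ∀ e ∈ rootedEdges G r,
      P e.1 e.2 = Matrix.diagonal (ψ e.1 * phiWithout A φ e.1 e.2) * A e.1 e.2 *
        Matrix.diagonal (φ e.2)

/-- The family `1 ./ v_r` at the root, `v_j` at the other leaves, the vector of ones elsewhere. -/
noncomputable def bridgeScaling (v : V → Fin n → ℝ) : V → Fin n → ℝ :=
  fun j => if j = r then 1 / v r else if j ∈ leaves G then v j else 1

end Problems

end TreeOT

/-! Each edge points from a parent `p k` to a child `k ≠ r`, so consistent edge bi-marginals `P`
with vertex marginals `ν` glue to a Markov chain on the tree: start with `ν r` and move into `k`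
with probabilities `P (p k) k a b / ν (p k) a`. This `bridgeTensor` has exactly the marginals `ν`
and bi-marginals `P` (`bridgeTensor_marginals`).

Because `C = -ε log A` on edges, the cost and the logarithm of the chain together split along the
edges. Gibbs' inequality then shows that among nonnegative tensors with marginals `ν` and edge
bi-marginals `P`, the transport objective is at least `bridgeValue`, which the chain attains
(`bridgeValue_le`, `otObjective_bridgeTensor`). Up to terms fixed by the root marginal,
`bridgeValue` is `ε` times the bridge objective. So the two problems have the same minimizers under
the passage to marginals (`isSBSolution_iff`), and existence and uniqueness need only be proved for
transport, by compactness and strict convexity.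

For positive data the minimizer is positive, since `m log m` has slope `-∞` at zero. Stationarity
then forces `log M + C/ε` to be a sum of functions of single leaf coordinates, which gives the
scaling vectors. In the factored form, the transition probabilities are `A` times `φ k` over `A φ
k`. In their product over the edges the denominators at each internal vertex cancel its `φ`, and
only the leaf vectors remain (`bridgeTensor_eq`). -/

namespace TreeOT

/-! ### Parents and depth in a rooted tree. -/

section Trees
variable {V : Type*} [Fintype V] [DecidableEq V]

/-- In a rooted tree every vertex other than the root has exactly one parent, which is closer to
the root. -/
lemma exists_parent {G : SimpleGraph V} (hG : G.IsTree) (r : V) :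
    ∃ (p : V → V) (d : V → ℕ), (∀ k, k ≠ r → d (p k) < d k) ∧
      rootedEdges G r = (univ.erase r).image fun k => (p k, k) := by
  choose q hq hq' using fun k => (hG.existsUnique_path r k)
  have hd : ∀ k, k ≠ r → (q (q k).penultimate).length < (q k).length := by
    intro k hk
    have hnil : ¬ (q k).Nil := SimpleGraph.Walk.not_nil_of_ne hk.symm
    have h1 : (q k).dropLast = q (q k).penultimate := hq' _ _ (hq k).dropLast
    have h2 : (q k).dropLast.length + 1 = (q k).length := by
      have h3 : (q k).length ≠ 0 := fun h => hnil (SimpleGraph.Walk.length_eq_zero_iff.1 h)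
      simp
      omega
    rw [← h1]; omega
  refine ⟨fun k => (q k).penultimate, fun k => (q k).length, hd, ?_⟩
  ext ⟨j, k⟩
  simp only [rootedEdges, mem_filter, mem_univ, true_and, mem_image, mem_erase, Prod.mk.injEq]
  constructor
  · rintro ⟨hadj, hne, w, hw, hj⟩
    have hadj' : G.Adj j k := hadj
    have hj' : j ∈ w.support := hj
    have hkn : k ∉ (w.takeUntil j hj').support := by
      intro hk
      exact SimpleGraph.Walk.endpoint_notMem_support_takeUntil hw hj' (Ne.symm hne) hk
    have h1 : ((w.takeUntil j hj').concat hadj').IsPath :=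
      (hw.takeUntil hj').concat hkn hadj'
    have h2 := hq' _ _ h1
    refine ⟨k, ⟨?_, trivial⟩, ?_, rfl⟩
    · rintro rfl
      exact hkn (SimpleGraph.Walk.start_mem_support _)
    · rw [← h2]; simp
  · rintro ⟨k', ⟨hk, -⟩, rfl, rfl⟩
    have hnil : ¬ (q k').Nil := SimpleGraph.Walk.not_nil_of_ne hk.symm
    have hadj := SimpleGraph.Walk.adj_penultimate hnil
    exact ⟨hadj, hadj.ne, q k', hq k', SimpleGraph.Walk.getVert_mem_support _ _⟩

/-- A leaf other than the root has no children. -/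
lemma notMem_rootedEdges_of_leaf {G : SimpleGraph V} [DecidableRel G.Adj] {r : V} {p : V → V}
    {d : V → ℕ} (hd : ∀ k, k ≠ r → d (p k) < d k)
    (hE : rootedEdges G r = (univ.erase r).image fun k => (p k, k))
    {j : V} (hj : j ∈ leaves G) (hjr : j ≠ r) (k : V) : (j, k) ∉ rootedEdges G r := by
  intro h
  have h1 : (p j, j) ∈ rootedEdges G r := by
    rw [hE]; exact mem_image.2 ⟨j, by simp [hjr], rfl⟩
  have hadj : ∀ e ∈ rootedEdges G r, G.Adj e.1 e.2 := fun e he => by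
    simp only [rootedEdges, mem_filter] at he
    exact he.2.1
  have a1 : G.Adj (p j) j := hadj _ h1
  have a2 : G.Adj j k := hadj _ h
  -- The parent and a child would both be the single neighbour of `j`, yet one is shallower and the
  -- other deeper.
  have hdeg : (G.neighborFinset j).card = 1 := (mem_filter.1 hj).2
  obtain ⟨c, hc⟩ := card_eq_one.1 hdeg
  have e1 : p j ∈ G.neighborFinset j := by simpa using a1.symm
  have e2 : k ∈ G.neighborFinset j := by simpa using a2
  rw [hc, mem_singleton] at e1 e2
  rw [hE] at h
  obtain ⟨k', hk', hkk⟩ := mem_image.1 h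
  simp only [Prod.mk.injEq] at hkk
  obtain ⟨h2, rfl⟩ := hkk
  have h3 := hd j hjr
  have h4 := hd k' (by simpa using hk')
  rw [h2] at h4
  rw [e1, ← e2] at h3
  omega

end Trees

/-! ### Markov chains on a tree and their marginals. -/

section Markov
variable {V : Type*} [Fintype V] [DecidableEq V] {n : ℕ}

lemma sum_sum_update (F : Tensor V n) (l : V) :
    ∑ x, ∑ b, F (Function.update x l b) = n * ∑ x, F x := by
  -- Exchanging the coordinate at `l` with the spare value is an involution of the pairs, so the sum
  -- can be reindexed to one that ignores the spare value.
  have hinv : Function.Involutive fun z : (V → Fin n) × Fin n =>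
      (Function.update z.1 l z.2, z.1 l) := by
    rintro ⟨x, b⟩; simp
  rw [← Fintype.sum_prod_type' (f := fun x b => F (Function.update x l b)),
    ← Equiv.sum_comp hinv.toPerm]
  simp only [Function.Involutive.coe_toPerm, Function.update_idem, Function.update_eq_self]
  rw [Fintype.sum_prod_type' (f := fun x _ => F x), mul_sum]
  simp

/-- The sum of a rank one tensor against the indicator of one coordinate. -/
lemma marginal_outer (u : V → Fin n → ℝ) (j : V) (a : Fin n) :
    marginal (outer u) j a = u j a * ∏ i ∈ univ.erase j, ∑ b, u i b := by
  have h : ∀ x : V → Fin n, (if x j = a then outer u x else 0)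
      = ∏ i, (if i = j then (if x i = a then u i (x i) else 0) else u i (x i)) := by
    intro x
    rw [outer, ← mul_prod_erase univ _ (mem_univ j), ← mul_prod_erase univ _ (mem_univ j)]
    have : ∏ i ∈ univ.erase j, (if i = j then (if x i = a then u i (x i) else 0) else u i (x i))
        = ∏ i ∈ univ.erase j, u i (x i) :=
      prod_congr rfl fun i hi => if_neg (ne_of_mem_erase hi)
    rw [this]
    by_cases hx : x j = a <;> simp [hx]
  rw [marginal, sum_filter]
  simp_rw [h]
  have := Finset.prod_univ_sum (fun _ : V => (univ : Finset (Fin n)))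
    (fun i c => if i = j then (if c = a then u i c else 0) else u i c)
  rw [Fintype.piFinset_univ] at this
  rw [← this, ← mul_prod_erase univ _ (mem_univ j)]
  congr 1
  · simp
  · exact prod_congr rfl fun i hi => by simp [ne_of_mem_erase hi]

/-- The tensor of the Markov chain on a rooted tree with initial weights `w` at the root and
transition matrix `Q k` into the vertex `k`. -/
def markovTensor (p : V → V) (r : V) (w : Fin n → ℝ) (Q : V → Fin n → Fin n → ℝ) : Tensor V n :=
  fun x => w (x r) * ∏ k ∈ univ.erase r, Q k (x (p k)) (x k)

/-- The factor at `k` of the Markov tensor in which the coordinates outside `S` are resampled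
uniformly. -/
noncomputable def partialFactor (p : V → V) (r : V) (w : Fin n → ℝ) (Q : V → Fin n → Fin n → ℝ)
    (S : Finset V) (k : V) : Tensor V n :=
  fun x => if k ∈ S then (if k = r then w (x r) else Q k (x (p k)) (x k)) else (n : ℝ)⁻¹

/-- Integrates out the coordinate `l`: what does not depend on it is kept, and the rest is replaced
by its average over that coordinate. -/
lemma sum_mul_of_resample (hn : (n : ℝ) ≠ 0) {l : V} {g h : Tensor V n} {H : Tensor V n}
    (hg : ∀ x b, g (Function.update x l b) = g x)
    (hh : ∀ x, ∑ b, h (Function.update x l b) = H x) :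
    ∑ x, g x * h x = ∑ x, g x * H x * (n : ℝ)⁻¹ := by
  have := sum_sum_update (fun x => g x * h x) l
  simp only [hg, ← mul_sum, hh] at this
  rw [← sum_mul, this]
  field_simp

/-- The chain is grown one vertex at a time over parent-closed sets `S`, the other coordinates
staying uniform. Row sums one preserve the old marginals; the new pair marginal is the parent's
marginal times the transition. -/
lemma markov_marginals_partial {p : V → V} {r : V} {d : V → ℕ}
    (hd : ∀ k, k ≠ r → d (p k) < d k) {ν : V → Fin n → ℝ} {Q : V → Fin n → Fin n → ℝ}
    (hQ : ∀ k, k ≠ r → ∀ a, ∑ b, Q k a b = 1)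
    (hν : ∀ k, k ≠ r → ∀ b, ∑ a, ν (p k) a * Q k a b = ν k b) (hdr : d r = 0) (S : Finset V) :
    (∀ k ∈ S, k ≠ r → p k ∈ S) →
    (∀ j ∈ S, ∀ a, ∑ x : V → Fin n, (∏ k, partialFactor p r (ν r) Q S k x) *
      (if x j = a then 1 else 0) = ν j a) ∧
    ∀ k ∈ S, k ≠ r → ∀ a b, ∑ x : V → Fin n, (∏ k, partialFactor p r (ν r) Q S k x) *
      ((if x (p k) = a then 1 else 0) * (if x k = b then 1 else 0)) = ν (p k) a * Q k a b := by
  rcases Nat.eq_zero_or_pos n with rfl | hn0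
  · exact fun _ => ⟨fun _ _ a => a.elim0, fun _ _ _ a => a.elim0⟩
  have hn : (n : ℝ) ≠ 0 := by positivity
  -- Vertices enter in order of depth, so the newest vertex `l` is nobody's parent in `S`.
  induction S using Finset.induction_on_max_value d with
  | empty => simp
  | insert l S hl hmax ih =>
    intro hcl
    have hpl : ∀ k ∈ S, k ≠ r → p k ≠ l := by
      rintro k hk hkr rfl
      exact absurd (hd k hkr) (not_lt.2 (hmax k hk))
    have hcl' : ∀ k ∈ S, k ≠ r → p k ∈ S := fun k hk hkr =>
      (mem_insert.1 (hcl k (mem_insert_of_mem hk) hkr)).resolve_left (hpl k hk hkr)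
    obtain ⟨ih1, ih2⟩ := ih hcl'
    by_cases hlr : l = r
    · have hS : S = ∅ := by
        refine eq_empty_of_forall_notMem fun k hk => ?_
        have hkr : k ≠ r := fun h => hl (by rw [hlr, ← h]; exact hk)
        have h1 := hd k hkr
        have h2 := hmax k hk
        rw [hlr, hdr] at h2
        omega
      subst hS
      subst hlr
      refine ⟨fun j hj a => ?_, fun k hk hkr => absurd (by simpa using hk) hkr⟩
      obtain rfl : j = l := by simpa using hj
      have h1 := marginal_outer (fun i b => if i = j then ν j b else (n : ℝ)⁻¹) j a
      have h2 : ∏ i ∈ univ.erase j, ∑ _b : Fin n, (if i = j then ν j _b else (n : ℝ)⁻¹) = 1 :=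
        prod_eq_one fun i hi => by simp [ne_of_mem_erase hi, hn]
      rw [h2, if_pos rfl, mul_one, marginal, sum_filter] at h1
      rw [← h1]
      refine sum_congr rfl fun x _ => ?_
      rw [mul_ite, mul_one, mul_zero]
      congr 1
      refine prod_congr rfl fun k _ => ?_
      by_cases hk : k = j
      · subst hk; simp [partialFactor]
      · simp [partialFactor, hk]
    -- `R` omits the factor at `l` and does not depend on that coordinate; the factor is `1/n`
    -- before `l` is added and `Q l` afterwards.
    · set R : Tensor V n := fun x => ∏ k ∈ univ.erase l, partialFactor p r (ν r) Q S k x with hR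
      have hT : ∀ x, ∏ k, partialFactor p r (ν r) Q S k x = R x * (n : ℝ)⁻¹ := fun x => by
        rw [← mul_prod_erase univ _ (mem_univ l), mul_comm]
        simp [partialFactor, hl, hR]
      have hT' : ∀ x, ∏ k, partialFactor p r (ν r) Q (insert l S) k x
          = R x * Q l (x (p l)) (x l) := fun x => by
        rw [← mul_prod_erase univ _ (mem_univ l), mul_comm]
        congr 1
        · refine prod_congr rfl fun k hk => ?_
          simp [partialFactor, ne_of_mem_erase hk]
        · simp [partialFactor, hlr]
      have hpll : p l ≠ l := fun h => by have := hd l hlr; rw [h] at this; omega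
      have hRl : ∀ x b, R (Function.update x l b) = R x := fun x b => by
        refine prod_congr rfl fun k hk => ?_
        have hkl := ne_of_mem_erase hk
        by_cases hkS : k ∈ S
        · by_cases hkr : k = r
          · simp [partialFactor, hkr, Ne.symm hlr]
          · simp [partialFactor, hkS, hkr, hpl k hkS hkr, hkl]
        · simp [partialFactor, hkS]
      have key : ∀ f : Tensor V n, (∀ x b, f (Function.update x l b) = f x) →
          ∑ x, (∏ k, partialFactor p r (ν r) Q (insert l S) k x) * f x
            = ∑ x, (∏ k, partialFactor p r (ν r) Q S k x) * f x := by
        intro f hf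
        have := sum_mul_of_resample hn (l := l) (g := fun x => R x * f x)
          (h := fun x => Q l (x (p l)) (x l)) (H := fun _ => 1)
          (fun x b => by simp only [hRl, hf]) (fun x => by simp [hpll, hQ l hlr])
        simp only [hT, hT']
        calc _ = ∑ x, R x * f x * Q l (x (p l)) (x l) := sum_congr rfl fun x _ => by ring
          _ = _ := this
          _ = _ := sum_congr rfl fun x _ => by ring
      have hnew : ∀ a b, ∑ x : V → Fin n, (∏ k, partialFactor p r (ν r) Q (insert l S) k x) *
          ((if x (p l) = a then 1 else 0) * (if x l = b then 1 else 0))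
            = ν (p l) a * Q l a b := by
        intro a b
        have := sum_mul_of_resample hn (l := l)
          (g := fun x => R x * (if x (p l) = a then 1 else 0))
          (h := fun x => Q l (x (p l)) (x l) * (if x l = b then 1 else 0))
          (H := fun x => Q l (x (p l)) b)
          (fun x b => by simp only [hRl, Function.update_of_ne hpll]) (fun x => by simp [hpll])
        have hpS : p l ∈ S :=
          (mem_insert.1 (hcl l (mem_insert_self _ _) hlr)).resolve_left hpll
        rw [← ih1 (p l) hpS a, sum_mul]
        simp only [hT, hT']
        calc _ = ∑ x : V → Fin n, R x * (if x (p l) = a then 1 else 0) *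
              (Q l (x (p l)) (x l) * (if x l = b then 1 else 0)) :=
              sum_congr rfl fun x _ => by ring
          _ = _ := this
          _ = _ := sum_congr rfl fun x _ => by
            by_cases hx : x (p l) = a
            · simp only [hx, if_true]; ring
            · simp [hx]
      have hind : ∀ j ∈ S, ∀ (a b : Fin n) (x : V → Fin n),
          (if Function.update x l b j = a then (1 : ℝ) else 0) = if x j = a then 1 else 0 :=
        fun j hj a b x => by
          rw [Function.update_of_ne (ne_of_mem_of_not_mem hj hl)]
      refine ⟨fun j hj a => ?_, fun k hk hkr a b => ?_⟩
      · rcases mem_insert.1 hj with rfl | hj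
        · rw [← hν j hlr a]
          simp_rw [← hnew]
          rw [sum_comm]
          refine sum_congr rfl fun x _ => ?_
          rw [← mul_sum, ← sum_mul]
          simp
        · rw [key _ fun x b => hind j hj a b x, ih1 j hj]
      · rcases mem_insert.1 hk with rfl | hk
        · exact hnew a b
        · rw [key (fun x => (if x (p k) = a then 1 else 0) * (if x k = b then 1 else 0))
            fun x c => by rw [hind k hk, hind _ (hcl' k hk hkr)], ih2 k hk hkr]

/-- The marginals and edge bi-marginals of a Markov tensor. -/
lemma markovTensor_marginals {p : V → V} {r : V} {d : V → ℕ}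
    (hd : ∀ k, k ≠ r → d (p k) < d k) {ν : V → Fin n → ℝ} {Q : V → Fin n → Fin n → ℝ}
    (hQ : ∀ k, k ≠ r → ∀ a, ∑ b, Q k a b = 1)
    (hν : ∀ k, k ≠ r → ∀ b, ∑ a, ν (p k) a * Q k a b = ν k b) :
    (∀ j, marginal (markovTensor p r (ν r) Q) j = ν j) ∧
    ∀ k, k ≠ r → ∀ a b, bimarginal (markovTensor p r (ν r) Q) (p k) k a b
      = ν (p k) a * Q k a b := by
  have hM : ∀ x, ∏ k, partialFactor p r (ν r) Q univ k x = markovTensor p r (ν r) Q x := by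
    intro x
    rw [markovTensor, ← mul_prod_erase univ _ (mem_univ r)]
    congr 1
    · simp [partialFactor]
    · exact prod_congr rfl fun k hk => by simp [partialFactor, ne_of_mem_erase hk]
  -- The depth is shifted so that the root has value zero, as the induction requires.
  have hd' : ∀ k, k ≠ r → (if p k = r then 0 else d (p k) + 1) < if k = r then 0 else d k + 1 := by
    intro k hk
    have := hd k hk
    rw [if_neg hk]
    split_ifs <;> omega
  obtain ⟨h1, h2⟩ := markov_marginals_partial (d := fun k => if k = r then 0 else d k + 1) hd' hQ hν
    (by simp) univ (fun _ _ _ => mem_univ _)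
  simp only [hM] at h1 h2
  refine ⟨fun j => funext fun a => ?_, fun k hk a b => ?_⟩
  · rw [← h1 j (mem_univ j) a, marginal, sum_filter]
    simp
  · rw [← h2 k (mem_univ k) hk a b, bimarginal, Matrix.of_apply, sum_filter]
    refine sum_congr rfl fun x _ => ?_
    by_cases hx : x (p k) = a <;> by_cases hy : x k = b <;> simp [hx, hy]

end Markov

/-! ### The transport problem: existence, uniqueness, positivity and scaling. -/

section Transport
variable {V : Type*} [Fintype V] [DecidableEq V] {n : ℕ}

lemma otObjective_eq_sum (ε : ℝ) (C M : Tensor V n) :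
    otObjective ε C M = ∑ x, (C x * M x + ε * (M x * Real.log (M x) - M x + 1)) := by
  simp only [otObjective, relEntropy, sum_add_distrib, ← mul_sum, div_one]

lemma marginal_eq_sum_mul (M : Tensor V n) (j : V) (a : Fin n) :
    marginal M j a = ∑ x : V → Fin n, (if x j = a then 1 else 0) * M x := by
  simp [marginal, sum_filter]

lemma sum_marginal (M : Tensor V n) (j : V) : ∑ a, marginal M j a = ∑ x, M x := by
  simp_rw [marginal_eq_sum_mul]
  rw [sum_comm]
  simp

lemma marginal_smul (c : ℝ) (M : Tensor V n) (j : V) :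
    marginal (c • M) j = c • marginal M j := by
  ext a
  simp [marginal, mul_sum]

lemma marginal_add (M M' : Tensor V n) (j : V) :
    marginal (M + M') j = marginal M j + marginal M' j := by
  ext a
  simp [marginal, sum_add_distrib]

/-- The constraints can be met, by a positive tensor if the given marginals are positive. -/
lemma exists_feasible {Γ : Finset V} (hΓ : Γ.Nonempty) {μ : V → Fin n → ℝ}
    (hμ : ∀ j ∈ Γ, ∀ i, 0 ≤ μ j i)
    (hmass : ∀ j ∈ Γ, ∀ k ∈ Γ, ∑ i, μ j i = ∑ i, μ k i) :
    ∃ M : Tensor V n, OTFeasible Γ μ M ∧ ((∀ j ∈ Γ, ∀ i, 0 < μ j i) → ∀ x, 0 < M x) := by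
  obtain ⟨j0, hj0⟩ := hΓ
  set m := ∑ i, μ j0 i with hm
  by_cases hm0 : m = 0
  · have hz : ∀ j ∈ Γ, ∀ a, μ j a = 0 := fun j hj a =>
      (sum_eq_zero_iff_of_nonneg fun i _ => hμ j hj i).1 ((hmass j hj j0 hj0).trans hm0) a
        (mem_univ a)
    refine ⟨0, ⟨fun _ => le_rfl, fun j hj => ?_⟩, fun hpos x => ?_⟩
    · ext a; simp [marginal, hz j hj a]
    · exact absurd (hz j0 hj0 (x j0)) (hpos j0 hj0 _).ne'
  · have hn : (n : ℝ) ≠ 0 := by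
      intro h
      obtain rfl : n = 0 := by exact_mod_cast h
      exact hm0 (by simp [hm])
    have hn' : 0 < (n : ℝ) := lt_of_le_of_ne n.cast_nonneg hn.symm
    have hmpos : 0 < m := lt_of_le_of_ne (sum_nonneg fun i _ => hμ j0 hj0 i) (Ne.symm hm0)
    -- Normalized product coupling, uniform on the unconstrained coordinates.
    set w : V → Fin n → ℝ := fun j a => if j ∈ Γ then μ j a / m else (n : ℝ)⁻¹ with hw
    have hw1 : ∀ j, ∑ a, w j a = 1 := fun j => by
      by_cases hj : j ∈ Γ
      · simp only [hw, if_pos hj]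
        rw [← sum_div, hmass j hj j0 hj0, ← hm, div_self hm0]
      · simp [hw, hj, hn]
    refine ⟨m • outer w, ⟨fun x => ?_, fun j hj => ?_⟩, fun hpos x => ?_⟩
    · refine mul_nonneg hmpos.le (prod_nonneg fun j _ => ?_)
      simp only [hw]
      split_ifs with hj
      · exact div_nonneg (hμ j hj _) hmpos.le
      · positivity
    · ext a
      rw [marginal_smul, Pi.smul_apply, marginal_outer, prod_eq_one fun i _ => hw1 i]
      simp only [hw, if_pos hj, smul_eq_mul, mul_one]
      field_simp
    · refine mul_pos hmpos (prod_pos fun j _ => ?_)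
      simp only [hw]
      split_ifs with hj
      · exact div_pos (hpos j hj _) hmpos
      · positivity

lemma strictConvexOn_entropyCost {ε : ℝ} (hε : 0 < ε) (c : ℝ) :
    StrictConvexOn ℝ (Set.Ici 0) fun m => c * m + ε * (m * Real.log m - m + 1) := by
  refine ⟨convex_Ici 0, fun s hs t ht hst a b ha hb hab => ?_⟩
  have h := mul_lt_mul_of_pos_left (Real.strictConvexOn_mul_log.2 hs ht hst ha hb hab) hε
  simp only [smul_eq_mul] at h ⊢
  have h1 : ε = ε * a + ε * b := by rw [← mul_add, hab, mul_one]
  linarith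

lemma strictConvexOn_otObjective {ε : ℝ} (hε : 0 < ε) (C : Tensor V n) :
    StrictConvexOn ℝ {M : Tensor V n | ∀ x, 0 ≤ M x} (otObjective ε C) := by
  refine ⟨fun M hM M' hM' a b ha hb _ x => ?_, fun M hM M' hM' hne a b ha hb hab => ?_⟩
  · exact add_nonneg (mul_nonneg ha (hM x)) (mul_nonneg hb (hM' x))
  · obtain ⟨x0, hx0⟩ := Function.ne_iff.1 hne
    simp only [otObjective_eq_sum, smul_eq_mul, mul_sum, ← sum_add_distrib]
    refine sum_lt_sum (fun x _ => ?_) ⟨x0, mem_univ _, ?_⟩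
    · exact (strictConvexOn_entropyCost hε (C x)).convexOn.2 (hM x) (hM' x) ha.le hb.le hab
    · exact (strictConvexOn_entropyCost hε (C x0)).2 (hM x0) (hM' x0) hx0 ha hb hab

lemma convex_feasible (Γ : Finset V) (μ : V → Fin n → ℝ) :
    Convex ℝ {M : Tensor V n | OTFeasible Γ μ M} := by
  refine fun M hM M' hM' a b ha hb hab => ⟨fun x => ?_, fun j hj => ?_⟩
  · exact add_nonneg (mul_nonneg ha (hM.1 x)) (mul_nonneg hb (hM'.1 x))
  · rw [marginal_add, marginal_smul, marginal_smul, hM.2 j hj, hM'.2 j hj, ← add_smul, hab,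
      one_smul]

/-- The transport problem has at most one solution. -/
lemma IsOTSolution.unique {ε : ℝ} (hε : 0 < ε) {C : Tensor V n} {Γ : Finset V}
    {μ : V → Fin n → ℝ} {M M' : Tensor V n} (h : IsOTSolution ε C Γ μ M)
    (h' : IsOTSolution ε C Γ μ M') : M = M' :=
  ((strictConvexOn_otObjective hε C).subset (fun _ hM => hM.1)
    (convex_feasible Γ μ)).eq_of_isMinOn h.2 h'.2 h.1 h'.1

/-- The transport problem has a solution. -/
lemma exists_isOTSolution (ε : ℝ) (C : Tensor V n) {Γ : Finset V} (hΓ : Γ.Nonempty)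
    {μ : V → Fin n → ℝ} (hμ : ∀ j ∈ Γ, ∀ i, 0 ≤ μ j i)
    (hmass : ∀ j ∈ Γ, ∀ k ∈ Γ, ∑ i, μ j i = ∑ i, μ k i) :
    ∃ M, IsOTSolution ε C Γ μ M := by
  obtain ⟨M₀, hM₀, -⟩ := exists_feasible hΓ hμ hmass
  obtain ⟨j, hj⟩ := hΓ
  have hclosed : IsClosed {M : Tensor V n | OTFeasible Γ μ M} := by
    have h1 : IsClosed {M : Tensor V n | ∀ x, 0 ≤ M x} := by
      simp only [Set.ofPred_forall]
      exact isClosed_iInter fun x => isClosed_le continuous_const (continuous_apply x)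
    have h2 : IsClosed {M : Tensor V n | ∀ j ∈ Γ, marginal M j = μ j} := by
      simp only [Set.ofPred_forall]
      refine isClosed_iInter fun j => isClosed_iInter fun _ => isClosed_eq ?_ continuous_const
      unfold marginal
      fun_prop
    exact h1.inter h2
  have hcomp : IsCompact {M : Tensor V n | OTFeasible Γ μ M} := by
    refine (isCompact_Icc (a := (0 : Tensor V n)) (b := fun _ => ∑ i, μ j i)).of_isClosed_subset
      hclosed fun M hM => ⟨hM.1, fun x => ?_⟩
    change M x ≤ ∑ i, μ j i
    rw [← hM.2 j hj, sum_marginal]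
    exact single_le_sum (fun y _ => hM.1 y) (mem_univ x)
  have hcont : Continuous (otObjective ε C) := by
    have h : otObjective ε C = fun M : Tensor V n =>
        ∑ x, (C x * M x + ε * (M x * Real.log (M x) - M x + 1)) :=
      funext fun M => otObjective_eq_sum ε C M
    rw [h]
    refine continuous_finsetSum _ fun x _ => ?_
    have := Real.continuous_mul_log.comp (continuous_apply (A := fun _ : V → Fin n => ℝ) x)
    simp only [Function.comp_def] at this
    fun_prop
  obtain ⟨M, hM, hmin⟩ := hcomp.exists_isMinOn ⟨M₀, hM₀⟩ hcont.continuousOn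
  exact ⟨M, hM, fun M' hM' => hmin hM'⟩

/-- If some feasible tensor is positive then the solution is positive. -/
lemma IsOTSolution.pos {ε : ℝ} (hε : 0 < ε) {C : Tensor V n} {Γ : Finset V}
    {μ : V → Fin n → ℝ} {M M₀ : Tensor V n} (h : IsOTSolution ε C Γ μ M)
    (h₀ : OTFeasible Γ μ M₀) (hpos : ∀ x, 0 < M₀ x) (x : V → Fin n) : 0 < M x := by
  refine lt_of_le_of_ne (h.1.1 x) fun hx => ?_
  -- Moving a fraction `t = exp (-s)` towards `M₀` changes the objective by at most `t` times the
  -- difference of values, minus `ε t s M₀ x` from the logarithm at the vanishing entry. Taking `s >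
  -- B` makes this a strict decrease.
  set B := (otObjective ε C M₀ - otObjective ε C M) / (ε * M₀ x) with hB
  set s := |B| + 1 with hs
  have hs0 : 0 < s := by positivity
  set t := Real.exp (-s) with ht
  have ht0 : 0 < t := Real.exp_pos _
  have ht1 : t < 1 := by rw [ht, Real.exp_lt_one_iff]; linarith
  have hc := convex_feasible Γ μ h.1 h₀ (by linarith : 0 ≤ 1 - t) ht0.le (by ring)
  have h1 := h.2 _ hc
  have h2 : otObjective ε C ((1 - t) • M + t • M₀) ≤
      (1 - t) * otObjective ε C M + t * otObjective ε C M₀ + ε * (t * M₀ x * -s) := by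
    have : ε * (t * M₀ x * -s) = ∑ y, if y = x then ε * (t * M₀ x * -s) else 0 := by simp
    rw [this]
    simp only [otObjective_eq_sum, mul_sum, ← sum_add_distrib]
    refine sum_le_sum fun y _ => ?_
    by_cases hy : y = x
    · subst hy
      have hl : Real.log (t * M₀ y) = -s + Real.log (M₀ y) := by
        rw [Real.log_mul ht0.ne' (hpos y).ne', ht, Real.log_exp]
      simp only [Pi.add_apply, Pi.smul_apply, smul_eq_mul, ← hx, mul_zero, zero_add, if_true, hl]
      apply le_of_eq
      ring
    · rw [if_neg hy, add_zero]
      exact (strictConvexOn_entropyCost hε (C y)).convexOn.2 (h.1.1 y) (h₀.1 y)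
        (by linarith) ht0.le (by ring)
  have h3 : t * (ε * M₀ x * s) ≤ t * (otObjective ε C M₀ - otObjective ε C M) := by linarith
  have h4 := le_of_mul_le_mul_left h3 ht0
  have h5 : 0 < ε * M₀ x := mul_pos hε (hpos x)
  have h6 : s ≤ B := by
    rw [hB, le_div_iff₀ h5]; linarith
  linarith [le_abs_self B]

/-- First order condition at a positive solution. -/
lemma IsOTSolution.sum_eq_zero {ε : ℝ} {C : Tensor V n} {Γ : Finset V}
    {μ : V → Fin n → ℝ} {M : Tensor V n} (h : IsOTSolution ε C Γ μ M) (hpos : ∀ x, 0 < M x)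
    {D : Tensor V n} (hD : ∀ j ∈ Γ, marginal D j = 0) :
    ∑ x, (C x + ε * Real.log (M x)) * D x = 0 := by
  have hder : HasDerivAt (fun t : ℝ => otObjective ε C (M + t • D))
      (∑ x, (C x + ε * Real.log (M x)) * D x) 0 := by
    simp only [otObjective_eq_sum]
    refine HasDerivAt.fun_sum fun x _ => ?_
    have h1 : HasDerivAt (fun t : ℝ => (M + t • D) x) (D x) 0 := by
      simpa using ((hasDerivAt_id (0 : ℝ)).mul_const (D x)).const_add (M x)
    have h0 : (M + (0 : ℝ) • D) x = M x := by simp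
    have h2 : HasDerivAt (fun t : ℝ => (M + t • D) x * Real.log ((M + t • D) x))
        ((Real.log (M x) + 1) * D x) 0 := by
      have h3 : HasDerivAt (fun m => m * Real.log m) (Real.log (M x) + 1) ((M + (0 : ℝ) • D) x) := by
        rw [h0]; exact Real.hasDerivAt_mul_log (hpos x).ne'
      exact h3.comp (0 : ℝ) h1
    refine ((h1.const_mul (C x)).fun_add
      (((h2.fun_sub h1).add_const 1).const_mul ε)).congr_deriv ?_
    ring
  refine IsLocalMin.hasDerivAt_eq_zero ?_ hder
  have hev : ∀ᶠ t : ℝ in nhds 0, ∀ x, 0 ≤ (M + t • D) x := by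
    refine Filter.eventually_all.2 fun x => ?_
    have hc : ContinuousAt (fun t : ℝ => (M + t • D) x) 0 := by
      simp only [Pi.add_apply, Pi.smul_apply]; fun_prop
    filter_upwards [hc.eventually_const_lt (u := 0) (by simpa using hpos x)] with t ht using ht.le
  filter_upwards [hev] with t ht
  have := h.2 (M + t • D) ⟨ht, fun j hj => by
    rw [marginal_add, marginal_smul, hD j hj, smul_zero, add_zero, h.1.2 j hj]⟩
  simpa using this

/-- A tensor whose marginals in `Γ` vanish, and which detects sums of functions of single
coordinates in `Γ`. -/
lemma exists_test_tensor (Γ : Finset V) (y x : V → Fin n) :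
    ∃ D : Tensor V n, (∀ j ∈ Γ, marginal D j = 0) ∧ ∀ g : Tensor V n,
      ∑ z, g z * D z = g x - g y - ∑ j ∈ Γ, (g (Function.update y j (x j)) - g y) := by
  -- `D` is the point mass at `x` minus that at `y`, corrected by the one-coordinate moves from `y`
  -- towards `x`. In the marginal at `i ∈ Γ` only the move at `i` contributes, and it cancels the
  -- first difference.
  have key : ∀ g : Tensor V n, ∑ z, g z * (Pi.single x 1 - Pi.single y 1 -
      ∑ j ∈ Γ, (Pi.single (Function.update y j (x j)) 1 - Pi.single y 1) : Tensor V n) z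
      = g x - g y - ∑ j ∈ Γ, (g (Function.update y j (x j)) - g y) := by
    intro g
    have h1 : ∀ w : V → Fin n, ∑ z, g z * (Pi.single w 1 : Tensor V n) z = g w := by
      intro w; simp [Pi.single_apply]
    simp only [Pi.sub_apply, Finset.sum_apply, mul_sub, mul_sum, sum_sub_distrib, h1]
    rw [sum_comm]
    congr 2
    · exact sum_congr rfl fun j _ => h1 _
    · rw [sum_comm]
      exact sum_congr rfl fun j _ => h1 _
  refine ⟨_, fun i hi => funext fun a => ?_, key⟩
  rw [marginal_eq_sum_mul, key, sum_eq_single_of_mem i hi]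
  · simp
  · intro j _ hj
    simp [Function.update_of_ne hj.symm]

/-- For positive given marginals the solution has scaling vectors. -/
lemma IsOTSolution.exists_isScaling {ε : ℝ} (hε : 0 < ε) {C : Tensor V n} {Γ : Finset V}
    (hΓ : Γ.Nonempty) {μ : V → Fin n → ℝ} (hμ : ∀ j ∈ Γ, ∀ i, 0 < μ j i)
    (hmass : ∀ j ∈ Γ, ∀ k ∈ Γ, ∑ i, μ j i = ∑ i, μ k i)
    {M : Tensor V n} (h : IsOTSolution ε C Γ μ M) :
    ∃ u, IsScaling (gibbs ε C) Γ M u := by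
  rcases isEmpty_or_nonempty (V → Fin n) with hE | ⟨⟨y⟩⟩
  · exact ⟨1, fun _ _ => one_pos, fun _ _ => rfl, Subsingleton.elim _ _⟩
  obtain ⟨M₀, hM₀, hM₀pos⟩ := exists_feasible hΓ (fun j hj i => (hμ j hj i).le) hmass
  have hpos := h.pos hε hM₀ (hM₀pos hμ)
  obtain ⟨j₀, hj₀⟩ := hΓ
  set f : Tensor V n := fun x => Real.log (M x) + C x / ε with hf
  -- Stationarity against the test tensor says that `f` is additive over the coordinates in `Γ`.
  have hf' : ∀ x, f x = f y + ∑ j ∈ Γ, (f (Function.update y j (x j)) - f y) := by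
    intro x
    obtain ⟨D, hD, hg⟩ := exists_test_tensor Γ y x
    have h1 := h.sum_eq_zero hpos hD
    have h2 : ∑ z, (C z + ε * Real.log (M z)) * D z = ε * ∑ z, f z * D z := by
      rw [mul_sum]
      refine sum_congr rfl fun z _ => ?_
      simp only [hf]
      field_simp
      ring
    rw [h2, hg f] at h1
    have := (mul_eq_zero.1 h1).resolve_left hε.ne'
    linarith
  -- The additive constant `f y` has to enter exactly once, and is put into the factor at `j₀`.
  refine ⟨fun j a => if j ∈ Γ then Real.exp (f (Function.update y j a) - f y +
    if j = j₀ then f y else 0) else 1, fun j i => ?_, fun j hj => ?_, ?_⟩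
  · dsimp only
    split_ifs <;> positivity
  · ext a; simp [hj]
  · ext x
    have h3 : ∏ j : V, (if j ∈ Γ then Real.exp (f (Function.update y j (x j)) - f y +
        if j = j₀ then f y else 0) else 1) = Real.exp (f x) := by
      rw [prod_ite_mem, univ_inter, ← Real.exp_sum, sum_add_distrib]
      simp only [sum_ite_eq', hj₀, if_true]
      rw [hf' x, add_comm]
    rw [Pi.mul_apply, outer, h3, gibbs, ← Real.exp_add]
    have : -C x / ε + f x = Real.log (M x) := by simp only [hf]; ring
    rw [this, Real.exp_log (hpos x)]

/-- Scaling vectors are unique up to constants with product one. -/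
lemma IsScaling.eq_smul {K M : Tensor V n} (hK : ∀ x, K x ≠ 0) {Γ : Finset V}
    {u w : V → Fin n → ℝ} (hu : IsScaling K Γ M u) (hw : IsScaling K Γ M w) :
    ∃ c : V → ℝ, (∀ j, 0 < c j) ∧ ∏ j ∈ Γ, c j = 1 ∧ ∀ j, u j = c j • w j := by
  rcases Nat.eq_zero_or_pos n with rfl | hn
  · exact ⟨1, fun _ => one_pos, by simp, fun j => Subsingleton.elim _ _⟩
  have houter : ∀ x : V → Fin n, ∏ j, u j (x j) = ∏ j, w j (x j) := fun x =>
    mul_left_cancel₀ (hK x) (congrFun (hu.2.2.symm.trans hw.2.2) x)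
  have hprod : ∀ x : V → Fin n, ∏ j, u j (x j) / w j (x j) = 1 := fun x => by
    rw [prod_div_distrib, houter, div_self (prod_ne_zero_iff.2 fun j _ => (hw.1 j _).ne')]
  set a₀ : Fin n := ⟨0, hn⟩
  set c : V → ℝ := fun j => u j a₀ / w j a₀ with hc
  have hcpos : ∀ j, 0 < c j := fun j => div_pos (hu.1 j _) (hw.1 j _)
  refine ⟨c, hcpos, ?_, fun j => funext fun a => ?_⟩
  · rw [← hprod fun _ => a₀]
    refine prod_subset (subset_univ _) fun j _ hj => ?_
    simp [hc, hu.2.1 j hj, hw.2.1 j hj]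
  -- Changing one coordinate of the constant index leaves the other ratios alone, so the ratio at
  -- `j` does not depend on its index.
  · have h1 := hprod (Function.update (fun _ => a₀) j a)
    have h2 := hprod fun _ => a₀
    rw [← mul_prod_erase univ _ (mem_univ j)] at h1 h2
    have h3 : ∏ i ∈ univ.erase j, u i (Function.update (fun _ => a₀) j a i) /
        w i (Function.update (fun _ => a₀) j a i) = ∏ i ∈ univ.erase j, u i a₀ / w i a₀ :=
      prod_congr rfl fun i hi => by rw [Function.update_of_ne (ne_of_mem_erase hi)]
    rw [h3, Function.update_self, ← h2] at h1
    have h4 : ∏ i ∈ univ.erase j, u i a₀ / w i a₀ ≠ 0 :=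
      prod_ne_zero_iff.2 fun i _ => (hcpos i).ne'
    have h5 : u j a / w j a = c j := mul_right_cancel₀ h4 h1
    rw [Pi.smul_apply, smul_eq_mul, ← h5, div_mul_cancel₀ _ (hw.1 j a).ne']

end Transport

/-! ### The bridge problem and its equivalence with transport. -/

section Bridge
variable {V : Type*} [Fintype V] [DecidableEq V] {n : ℕ}

lemma sum_mul_comp_marginal (M : Tensor V n) (j : V) (g : Fin n → ℝ) :
    ∑ x : V → Fin n, M x * g (x j) = ∑ a, marginal M j a * g a := by
  simp_rw [marginal_eq_sum_mul, sum_mul]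
  rw [sum_comm]
  refine sum_congr rfl fun x _ => ?_
  simp

lemma bimarginal_eq_sum_mul (M : Tensor V n) (j k : V) (a b : Fin n) :
    bimarginal M j k a b =
      ∑ x : V → Fin n, (if x j = a then 1 else 0) * ((if x k = b then 1 else 0) * M x) := by
  rw [bimarginal, Matrix.of_apply, sum_filter]
  refine sum_congr rfl fun x _ => ?_
  by_cases hx : x j = a <;> by_cases hy : x k = b <;> simp [hx, hy]

lemma sum_mul_comp_bimarginal (M : Tensor V n) (j k : V) (g : Fin n → Fin n → ℝ) :
    ∑ x : V → Fin n, M x * g (x j) (x k) = ∑ a, ∑ b, bimarginal M j k a b * g a b := by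
  have h : ∀ a, ∑ b, bimarginal M j k a b * g a b =
      ∑ x : V → Fin n, (if x j = a then 1 else 0) * (M x * g a (x k)) := fun a => by
    simp_rw [bimarginal_eq_sum_mul, sum_mul]
    rw [sum_comm]
    refine sum_congr rfl fun x _ => ?_
    simp
  simp_rw [h]
  rw [sum_comm]
  refine sum_congr rfl fun x _ => ?_
  simp

lemma sum_bimarginal_right (M : Tensor V n) (j k : V) (a : Fin n) :
    ∑ b, bimarginal M j k a b = marginal M j a := by
  simp_rw [bimarginal_eq_sum_mul, marginal_eq_sum_mul]
  rw [sum_comm]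
  refine sum_congr rfl fun x _ => ?_
  simp

lemma sum_bimarginal_left (M : Tensor V n) (j k : V) (b : Fin n) :
    ∑ a, bimarginal M j k a b = marginal M k b := by
  simp_rw [bimarginal_eq_sum_mul, marginal_eq_sum_mul]
  rw [sum_comm]
  refine sum_congr rfl fun x _ => ?_
  simp

lemma le_marginal {M : Tensor V n} (hM : ∀ x, 0 ≤ M x) (j : V) (x : V → Fin n) :
    M x ≤ marginal M j (x j) :=
  single_le_sum (f := M) (fun y _ => hM y) (by simp)

lemma le_bimarginal {M : Tensor V n} (hM : ∀ x, 0 ≤ M x) (j k : V) (x : V → Fin n) :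
    M x ≤ bimarginal M j k (x j) (x k) :=
  single_le_sum (f := M) (fun y _ => hM y) (by simp)

/-- The transition probabilities into the vertex `k` of a family of bi-marginals. Where the
marginal of the parent vanishes the given stochastic matrix is used instead. -/
noncomputable def transition (p : V → V) (A : V → V → Matrix (Fin n) (Fin n) ℝ)
    (ν : V → Fin n → ℝ) (P : V → V → Matrix (Fin n) (Fin n) ℝ) (k : V) (a b : Fin n) : ℝ :=
  if ν (p k) a = 0 then A (p k) k a b else P (p k) k a b / ν (p k) a

/-- The Markov tensor with given bi-marginals along the edges. -/
noncomputable def bridgeTensor (p : V → V) (r : V) (A : V → V → Matrix (Fin n) (Fin n) ℝ)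
    (ν : V → Fin n → ℝ) (P : V → V → Matrix (Fin n) (Fin n) ℝ) : Tensor V n :=
  markovTensor p r (ν r) (transition p A ν P)

variable {G : SimpleGraph V} {r : V} {p : V → V} {d : V → ℕ}

/-- A positive entry of `M` lies below every marginal through it, so on the support of `M` the
default branch of `transition` never occurs and logarithms split. -/
lemma transition_pos (A : V → V → Matrix (Fin n) (Fin n) ℝ) {ν : V → Fin n → ℝ}
    {P : V → V → Matrix (Fin n) (Fin n) ℝ} {M : Tensor V n} (hM : ∀ x, 0 ≤ M x)
    (hν : ∀ j, marginal M j = ν j) (hP : ∀ k, k ≠ r → bimarginal M (p k) k = P (p k) k)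
    {x : V → Fin n} (hx : 0 < M x) {k : V} (hk : k ≠ r) :
    0 < ν (p k) (x (p k)) ∧ 0 < P (p k) k (x (p k)) (x k) ∧
      transition p A ν P k (x (p k)) (x k) =
        P (p k) k (x (p k)) (x k) / ν (p k) (x (p k)) := by
  have h1 : 0 < ν (p k) (x (p k)) := hν (p k) ▸ hx.trans_le (le_marginal hM (p k) x)
  have h2 : 0 < P (p k) k (x (p k)) (x k) := hP k hk ▸ hx.trans_le (le_bimarginal hM (p k) k x)
  exact ⟨h1, h2, by rw [transition, if_neg h1.ne']⟩

lemma bridgeTensor_pos (A : V → V → Matrix (Fin n) (Fin n) ℝ) {ν : V → Fin n → ℝ}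
    {P : V → V → Matrix (Fin n) (Fin n) ℝ} {M : Tensor V n} (hM : ∀ x, 0 ≤ M x)
    (hν : ∀ j, marginal M j = ν j) (hP : ∀ k, k ≠ r → bimarginal M (p k) k = P (p k) k)
    {x : V → Fin n} (hx : 0 < M x) : 0 < bridgeTensor p r A ν P x := by
  have h0 : 0 < ν r (x r) := hν r ▸ hx.trans_le (le_marginal hM r x)
  refine mul_pos h0 (prod_pos fun k hk => ?_)
  obtain ⟨h1, h2, h3⟩ := transition_pos A hM hν hP hx (ne_of_mem_erase hk)
  rw [h3]
  exact div_pos h2 h1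

lemma forall_mem_rootedEdges (hE : rootedEdges G r = (univ.erase r).image fun k => (p k, k))
    {Φ : V → V → Prop} : (∀ e ∈ rootedEdges G r, Φ e.1 e.2) ↔ ∀ k, k ≠ r → Φ (p k) k := by
  rw [hE]
  simp

lemma sum_rootedEdges (hE : rootedEdges G r = (univ.erase r).image fun k => (p k, k))
    (f : V → V → ℝ) : ∑ e ∈ rootedEdges G r, f e.1 e.2 = ∑ k ∈ univ.erase r, f (p k) k := by
  rw [hE, sum_image]
  intro a _ b _ h
  exact (Prod.mk.inj h).2

variable [DecidableRel G.Adj]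

lemma sbFeasible_iff (hE : rootedEdges G r = (univ.erase r).image fun k => (p k, k))
    {μ ν : V → Fin n → ℝ} {P : V → V → Matrix (Fin n) (Fin n) ℝ} :
    SBFeasible G r μ ν P ↔ (∀ j ∈ leaves G, ν j = μ j) ∧ ∀ k, k ≠ r →
      (∀ a b, 0 ≤ P (p k) k a b) ∧ (∀ a, ∑ b, P (p k) k a b = ν (p k) a) ∧
        ∀ b, ∑ a, P (p k) k a b = ν k b := by
  rw [SBFeasible, forall_mem_rootedEdges hE (Φ := fun j k => (∀ a b, 0 ≤ P j k a b) ∧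
    Matrix.mulVec (P j k) 1 = ν j ∧ Matrix.mulVec (P j k).transpose 1 = ν k)]
  simp only [funext_iff, Matrix.mulVec, dotProduct, Matrix.transpose_apply, Pi.one_apply, mul_one]

section Transition
variable {A : V → V → Matrix (Fin n) (Fin n) ℝ} {μ ν : V → Fin n → ℝ}
  {P : V → V → Matrix (Fin n) (Fin n) ℝ}
  (hE : rootedEdges G r = (univ.erase r).image fun k => (p k, k))
  (hA_row : ∀ k, k ≠ r → ∀ a, ∑ b, A (p k) k a b = 1)
  (hf : SBFeasible G r μ ν P)
include hE hf

/-- Where `ν` vanishes, the corresponding nonnegative row of `P` sums to zero and so vanishes, which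
makes the default harmless. -/
lemma mul_transition {k : V} (hk : k ≠ r) (a b : Fin n) :
    ν (p k) a * transition p A ν P k a b = P (p k) k a b := by
  obtain ⟨h0, h1, -⟩ := ((sbFeasible_iff hE).1 hf).2 k hk
  rw [transition]
  split_ifs with h
  · have := (sum_eq_zero_iff_of_nonneg fun b _ => h0 a b).1 ((h1 a).trans h) b (mem_univ b)
    rw [h, zero_mul, this]
  · rw [mul_div_cancel₀ _ h]

include hA_row in
lemma sum_transition {k : V} (hk : k ≠ r) (a : Fin n) : ∑ b, transition p A ν P k a b = 1 := by
  obtain ⟨h0, h1, -⟩ := ((sbFeasible_iff hE).1 hf).2 k hk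
  unfold transition
  split_ifs with h
  · exact hA_row k hk a
  · rw [← sum_div, h1, div_self h]

include hA_row in
lemma bridgeTensor_marginals (hd : ∀ k, k ≠ r → d (p k) < d k) :
    (∀ j, marginal (bridgeTensor p r A ν P) j = ν j) ∧
      ∀ k, k ≠ r → bimarginal (bridgeTensor p r A ν P) (p k) k = P (p k) k := by
  obtain ⟨h1, h2⟩ := markovTensor_marginals hd (ν := ν) (Q := transition p A ν P)
    (fun k hk a => sum_transition hE hA_row hf hk a) (fun k hk b => by
      simp only [mul_transition hE hf hk]
      exact (((sbFeasible_iff hE).1 hf).2 k hk).2.2 b)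
  refine ⟨h1, fun k hk => ?_⟩
  ext a b
  exact (h2 k hk a b).trans (mul_transition hE hf hk a b)

lemma bridgeTensor_nonneg (hr : r ∈ leaves G) (hμ : ∀ j ∈ leaves G, ∀ i, 0 ≤ μ j i)
    (hA_pos : ∀ k, k ≠ r → ∀ a b, 0 < A (p k) k a b) (x : V → Fin n) :
    0 ≤ bridgeTensor p r A ν P x := by
  obtain ⟨h1, h2⟩ := (sbFeasible_iff hE).1 hf
  refine mul_nonneg (by rw [h1 r hr]; exact hμ r hr _) (prod_nonneg fun k hk => ?_)
  have hk := ne_of_mem_erase hk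
  rw [transition]
  split_ifs
  · exact (hA_pos k hk _ _).le
  · rw [← (h2 k hk).2.1]
    exact div_nonneg ((h2 k hk).1 _ _) (sum_nonneg fun b _ => (h2 k hk).1 _ _)

lemma sbObjective_eq (hA_row : ∀ k, k ≠ r → ∀ a, ∑ b, A (p k) k a b = 1) :
    sbObjective G r A ν P = ∑ k ∈ univ.erase r, ∑ a, ∑ b,
      P (p k) k a b * Real.log (P (p k) k a b / (ν (p k) a * A (p k) k a b)) := by
  rw [sbObjective, sum_rootedEdges hE
    (fun j k => matRelEntropy (P j k) (Matrix.diagonal (ν j) * A j k))]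
  refine sum_congr rfl fun k hk => ?_
  have hk := ne_of_mem_erase hk
  obtain ⟨-, h1, -⟩ := ((sbFeasible_iff hE).1 hf).2 k hk
  rw [matRelEntropy, relEntropy, Fintype.sum_prod_type]
  refine sum_congr rfl fun a _ => ?_
  simp only [Matrix.diagonal_mul, sum_add_distrib, sum_sub_distrib, h1, ← mul_sum, hA_row k hk]
  ring

end Transition

lemma sbFeasible_marginals (hE : rootedEdges G r = (univ.erase r).image fun k => (p k, k))
    {μ : V → Fin n → ℝ} {M : Tensor V n} (hM : OTFeasible (leaves G) μ M) :
    SBFeasible G r μ (marginal M) (bimarginal M) := by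
  refine (sbFeasible_iff hE).2 ⟨hM.2, fun k _ => ⟨fun a b => ?_, fun a => ?_, fun b => ?_⟩⟩
  · exact sum_nonneg fun x _ => hM.1 x
  · exact sum_bimarginal_right M _ _ a
  · exact sum_bimarginal_left M _ _ b

lemma SBFeasible.congr (hE : rootedEdges G r = (univ.erase r).image fun k => (p k, k))
    {μ ν ν' : V → Fin n → ℝ} {P P' : V → V → Matrix (Fin n) (Fin n) ℝ}
    (h : SBFeasible G r μ ν P) (hν : ∀ j, ν j = ν' j)
    (hP : ∀ k, k ≠ r → P (p k) k = P' (p k) k) : SBFeasible G r μ ν' P' := by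
  obtain rfl : ν = ν' := funext hν
  rw [sbFeasible_iff hE] at h ⊢
  refine ⟨h.1, fun k hk => ?_⟩
  rw [← hP k hk]
  exact h.2 k hk

/-- The data and standing assumptions of the bridge problem on a rooted tree. -/
structure BridgeData (G : SimpleGraph V) [DecidableRel G.Adj] (r : V) (p : V → V) (d : V → ℕ)
    (μ : V → Fin n → ℝ) (A C : V → V → Matrix (Fin n) (Fin n) ℝ) (ε : ℝ) : Prop where
  parent_lt : ∀ k, k ≠ r → d (p k) < d k
  edges : rootedEdges G r = (univ.erase r).image fun k => (p k, k)
  root_mem : r ∈ leaves G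
  nonneg : ∀ j ∈ leaves G, ∀ i, 0 ≤ μ j i
  pos : ∀ k, k ≠ r → ∀ a b, 0 < A (p k) k a b
  row_sum : ∀ k, k ≠ r → ∀ a, ∑ b, A (p k) k a b = 1
  eps_pos : 0 < ε
  exp_eq : ∀ k, k ≠ r → ∀ a b, Real.exp (-C (p k) k a b / ε) = A (p k) k a b

/-- The value of the transport objective at the Markov tensor of a feasible point of the bridge
problem. -/
noncomputable def bridgeValue (G : SimpleGraph V) (r : V)
    (A : V → V → Matrix (Fin n) (Fin n) ℝ) (ε : ℝ)
    (ν : V → Fin n → ℝ) (P : V → V → Matrix (Fin n) (Fin n) ℝ) : ℝ :=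
  ε * (∑ a, ν r a * Real.log (ν r a) + sbObjective G r A ν P) +
    ε * ∑ _x : V → Fin n, (1 : ℝ) - ε * ∑ a, ν r a

namespace BridgeData
variable {μ : V → Fin n → ℝ} {A C : V → V → Matrix (Fin n) (Fin n) ℝ} {ε : ℝ}
  (H : BridgeData G r p d μ A C ε)
include H

lemma cost_eq {k : V} (hk : k ≠ r) (a b : Fin n) :
    C (p k) k a b = -(ε * Real.log (A (p k) k a b)) := by
  have := H.eps_pos.ne'
  rw [← H.exp_eq k hk, Real.log_exp]
  field_simp

lemma gibbs_apply (x : V → Fin n) :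
    gibbs ε (treeCost G r C) x = ∏ k ∈ univ.erase r, A (p k) k (x (p k)) (x k) := by
  rw [gibbs, treeCost, sum_rootedEdges H.edges (fun j k => C j k (x j) (x k)), ← sum_neg_distrib,
    sum_div, Real.exp_sum]
  exact prod_congr rfl fun k hk => H.exp_eq k (ne_of_mem_erase hk) _ _

variable {ν : V → Fin n → ℝ} {P : V → V → Matrix (Fin n) (Fin n) ℝ}

lemma otFeasible_bridgeTensor (hf : SBFeasible G r μ ν P) :
    OTFeasible (leaves G) μ (bridgeTensor p r A ν P) := by
  refine ⟨bridgeTensor_nonneg H.edges hf H.root_mem H.nonneg H.pos, fun j hj => ?_⟩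
  rw [(bridgeTensor_marginals H.edges H.row_sum hf H.parent_lt).1 j]
  exact hf.1 j hj

section Compare
variable {M : Tensor V n} (hM : ∀ x, 0 ≤ M x) (hν : ∀ j, marginal M j = ν j)
  (hP : ∀ k, k ≠ r → bimarginal M (p k) k = P (p k) k)
include hM hν hP

/-- The logarithm of the chain is a root term plus edge terms, and the cost supplies the `log A` of
each edge; integrating against `M` sees only its root marginal and edge bi-marginals. Entries with
`M x = 0` contribute nothing. -/
lemma sum_cost_add_log (hf : SBFeasible G r μ ν P) :
    ∑ x, (treeCost G r C x * M x + ε * (M x * Real.log (bridgeTensor p r A ν P x))) =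
      ε * (∑ a, ν r a * Real.log (ν r a) + sbObjective G r A ν P) := by
  have hpt : ∀ x, treeCost G r C x * M x + ε * (M x * Real.log (bridgeTensor p r A ν P x)) =
      ε * (M x * Real.log (ν r (x r)) + ∑ k ∈ univ.erase r, M x *
        Real.log (P (p k) k (x (p k)) (x k) /
          (ν (p k) (x (p k)) * A (p k) k (x (p k)) (x k)))) := by
    intro x
    rcases (hM x).eq_or_lt with hx | hx
    · simp [← hx]
    have h0 : 0 < ν r (x r) := hν r ▸ hx.trans_le (le_marginal hM r x)
    have hk := fun k hk => transition_pos A hM hν hP hx (k := k) hk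
    have hlog : Real.log (bridgeTensor p r A ν P x) = Real.log (ν r (x r)) +
        ∑ k ∈ univ.erase r, (Real.log (P (p k) k (x (p k)) (x k)) -
          Real.log (ν (p k) (x (p k)))) := by
      have hne : ∀ k ∈ univ.erase r, transition p A ν P k (x (p k)) (x k) ≠ 0 := fun k hk' => by
        obtain ⟨h1, h2, h3⟩ := hk k (ne_of_mem_erase hk')
        rw [h3]; exact (div_pos h2 h1).ne'
      rw [bridgeTensor, markovTensor, Real.log_mul h0.ne' (prod_ne_zero_iff.2 hne),
        Real.log_prod hne]
      congr 1
      refine sum_congr rfl fun k hk' => ?_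
      obtain ⟨h1, h2, h3⟩ := hk k (ne_of_mem_erase hk')
      rw [h3, Real.log_div h2.ne' h1.ne']
    have hC : treeCost G r C x = -ε * ∑ k ∈ univ.erase r,
        Real.log (A (p k) k (x (p k)) (x k)) := by
      rw [treeCost, sum_rootedEdges H.edges (fun j k => C j k (x j) (x k)), mul_sum]
      exact sum_congr rfl fun k hk' => by rw [H.cost_eq (ne_of_mem_erase hk')]; ring
    have hsum : ∑ k ∈ univ.erase r, M x * Real.log (P (p k) k (x (p k)) (x k) /
          (ν (p k) (x (p k)) * A (p k) k (x (p k)) (x k))) =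
        M x * (∑ k ∈ univ.erase r, (Real.log (P (p k) k (x (p k)) (x k)) -
          Real.log (ν (p k) (x (p k)))) - ∑ k ∈ univ.erase r,
            Real.log (A (p k) k (x (p k)) (x k))) := by
      rw [← sum_sub_distrib, mul_sum]
      refine sum_congr rfl fun k hk' => ?_
      have hkr := ne_of_mem_erase hk'
      obtain ⟨h1, h2, -⟩ := hk k hkr
      have h4 := H.pos k hkr (x (p k)) (x k)
      rw [Real.log_div h2.ne' (mul_pos h1 h4).ne', Real.log_mul h1.ne' h4.ne']
      ring
    rw [hsum, hlog, hC]
    ring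
  rw [sum_congr rfl fun x _ => hpt x, ← mul_sum, sum_add_distrib, sum_comm,
    sum_mul_comp_marginal M r fun a => Real.log (ν r a), hν,
    sbObjective_eq H.edges hf H.row_sum]
  congr 2
  refine sum_congr rfl fun k hk => ?_
  rw [sum_mul_comp_bimarginal M (p k) k fun a b =>
    Real.log (P (p k) k a b / (ν (p k) a * A (p k) k a b)), hP k (ne_of_mem_erase hk)]

/-- Gibbs' inequality between `M` and the chain `q`: entrywise `M log (q / M) ≤ q - M`, from `log t
≤ t - 1`. -/
lemma bridgeValue_le (hf : SBFeasible G r μ ν P) :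
    bridgeValue G r A ε ν P ≤ otObjective ε (treeCost G r C) M := by
  have hf' := H.otFeasible_bridgeTensor hf
  have hmass : ∑ x, bridgeTensor p r A ν P x = ∑ a, ν r a := by
    rw [← sum_marginal _ r, (bridgeTensor_marginals H.edges H.row_sum hf H.parent_lt).1]
  rw [bridgeValue, ← H.sum_cost_add_log hM hν hP hf, otObjective_eq_sum, ← hmass, mul_sum, mul_sum,
    ← sum_add_distrib, ← sum_sub_distrib]
  refine sum_le_sum fun x _ => ?_
  rcases (hM x).eq_or_lt with hx | hx
  · have := mul_nonneg H.eps_pos.le (hf'.1 x)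
    simp only [← hx, mul_zero, zero_mul]
    linarith
  · have hq := bridgeTensor_pos A hM hν hP hx
    have h1 := Real.log_le_sub_one_of_pos (div_pos hq hx)
    rw [Real.log_div hq.ne' hx.ne'] at h1
    have h2 := mul_le_mul_of_nonneg_left h1 hx.le
    rw [mul_sub, mul_sub, mul_div_cancel₀ _ hx.ne'] at h2
    have h3 := mul_le_mul_of_nonneg_left h2 H.eps_pos.le
    linarith

end Compare

lemma otObjective_bridgeTensor (hf : SBFeasible G r μ ν P) :
    otObjective ε (treeCost G r C) (bridgeTensor p r A ν P) = bridgeValue G r A ε ν P := by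
  have hf' := H.otFeasible_bridgeTensor hf
  obtain ⟨h1, h2⟩ := bridgeTensor_marginals H.edges H.row_sum hf H.parent_lt
  have hmass : ∑ x, bridgeTensor p r A ν P x = ∑ a, ν r a := by
    rw [← sum_marginal _ r, h1]
  rw [bridgeValue, ← H.sum_cost_add_log hf'.1 h1 h2 hf, otObjective_eq_sum, ← hmass, mul_sum,
    mul_sum, ← sum_add_distrib, ← sum_sub_distrib]
  exact sum_congr rfl fun x _ => by ring

/-- The root is a leaf, so its marginal is prescribed and the remaining terms of `bridgeValue` agree
at all feasible points. -/
lemma bridgeValue_le_iff {ν' : V → Fin n → ℝ} {P' : V → V → Matrix (Fin n) (Fin n) ℝ}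
    (hf : SBFeasible G r μ ν P) (hf' : SBFeasible G r μ ν' P') :
    bridgeValue G r A ε ν P ≤ bridgeValue G r A ε ν' P' ↔
      sbObjective G r A ν P ≤ sbObjective G r A ν' P' := by
  rw [bridgeValue, bridgeValue, hf.1 r H.root_mem, hf'.1 r H.root_mem]
  rw [sub_le_sub_iff_right, add_le_add_iff_right, mul_le_mul_iff_right₀ H.eps_pos,
    add_le_add_iff_left]

/-- The Markov tensor of a solution of the bridge problem solves the transport problem. -/
lemma isOTSolution_bridgeTensor (h : IsSBSolution G r A μ ν P) :
    IsOTSolution ε (treeCost G r C) (leaves G) μ (bridgeTensor p r A ν P) := by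
  refine ⟨H.otFeasible_bridgeTensor h.1, fun M hM => ?_⟩
  have hf := sbFeasible_marginals H.edges hM
  rw [H.otObjective_bridgeTensor h.1]
  exact ((H.bridgeValue_le_iff h.1 hf).2 (h.2 _ _ hf)).trans
    (H.bridgeValue_le hM.1 (fun _ => rfl) (fun _ _ => rfl) hf)

/-- The bridge problem is solved exactly by the marginals of the solution of the transport
problem. -/
lemma isSBSolution_iff {M : Tensor V n}
    (hM : IsOTSolution ε (treeCost G r C) (leaves G) μ M) :
    IsSBSolution G r A μ ν P ↔ (∀ j, marginal M j = ν j) ∧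
      ∀ e ∈ rootedEdges G r, bimarginal M e.1 e.2 = P e.1 e.2 := by
  rw [forall_mem_rootedEdges H.edges (Φ := fun j k => bimarginal M j k = P j k)]
  constructor
  · intro h
    rw [hM.unique H.eps_pos (H.isOTSolution_bridgeTensor h)]
    exact bridgeTensor_marginals H.edges H.row_sum h.1 H.parent_lt
  · rintro ⟨hν, hP⟩
    have hf := (sbFeasible_marginals H.edges hM.1).congr H.edges hν hP
    refine ⟨hf, fun ν' P' hf' => (H.bridgeValue_le_iff hf hf').1 ?_⟩
    rw [← H.otObjective_bridgeTensor hf']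
    exact (H.bridgeValue_le hM.1.1 hν hP hf).trans (hM.2 _ (H.otFeasible_bridgeTensor hf'))

end BridgeData

end Bridge

/-! ### Backward and forward factors, and scaling vectors. -/

section Factorization
variable {V : Type*} [Fintype V] [DecidableEq V] {n : ℕ}

lemma exists_fix {α β : Type*} {R : α → α → Prop} (hR : WellFounded R)
    (F : ∀ x, (∀ y, R y x → β) → β) : ∃ f : α → β, ∀ x, f x = F x fun y _ => f y :=
  ⟨hR.fix F, hR.fix_eq F⟩

lemma mulVec_pos {B : Matrix (Fin n) (Fin n) ℝ} {f : Fin n → ℝ} (hB : ∀ a b, 0 < B a b)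
    (hf : ∀ b, 0 < f b) (a : Fin n) : 0 < Matrix.mulVec B f a :=
  sum_pos (fun b _ => mul_pos (hB a b) (hf b)) ⟨a, mem_univ a⟩

variable {G : SimpleGraph V} [DecidableRel G.Adj] {r : V} {p : V → V} {d : V → ℕ}

namespace BridgeData
variable {μ : V → Fin n → ℝ} {A C : V → V → Matrix (Fin n) (Fin n) ℝ} {ε : ℝ}
  (H : BridgeData G r p d μ A C ε)
include H

lemma mem_children {j k : V} : k ∈ children G r j ↔ k ≠ r ∧ p k = j := by
  simp only [children, mem_filter, mem_univ, true_and, H.edges, mem_image, mem_erase,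
    Prod.mk.injEq, and_true]
  exact ⟨fun ⟨k', h1, h2, h3⟩ => h3 ▸ ⟨h1, h2⟩, fun ⟨h1, h2⟩ => ⟨k, h1, h2, rfl⟩⟩

lemma children_eq (j : V) : children G r j = {k ∈ univ.erase r | p k = j} := by
  ext k
  simp [H.mem_children]

lemma children_leaf {j : V} (hj : j ∈ leaves G) (hjr : j ≠ r) : children G r j = ∅ := by
  refine eq_empty_of_forall_notMem fun k hk => ?_
  exact notMem_rootedEdges_of_leaf H.parent_lt H.edges hj hjr k (mem_filter.1 hk).2

lemma wellFounded_child : WellFounded fun k j => k ∈ children G r j := by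
  -- Children are deeper, so depth is measured down from its maximum.
  refine Subrelation.wf (r := InvImage (· < ·) fun k => univ.sup d - d k) ?_
    (InvImage.wf _ wellFounded_lt)
  intro k j hk
  obtain ⟨h1, rfl⟩ := H.mem_children.1 hk
  have h2 := H.parent_lt k h1
  have h3 : d k ≤ univ.sup d := le_sup (mem_univ k)
  change univ.sup d - d k < univ.sup d - d (p k)
  omega

lemma wellFounded_parent : WellFounded fun j k => k ≠ r ∧ j = p k := by
  refine Subrelation.wf (r := InvImage (· < ·) d) ?_ (InvImage.wf _ wellFounded_lt)
  rintro j k ⟨h1, rfl⟩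
  exact H.parent_lt k h1

lemma exists_backward (v : V → Fin n → ℝ) : ∃ φ : V → Fin n → ℝ,
    (∀ j ∈ leaves G, j ≠ r → φ j = v j) ∧
    ∀ j, j ∉ leaves G ∨ j = r → φ j = ∏ k ∈ children G r j, Matrix.mulVec (A j k) (φ k) := by
  obtain ⟨φ, hφ⟩ := exists_fix (β := Fin n → ℝ) H.wellFounded_child fun j g =>
    if j ∈ leaves G ∧ j ≠ r then v j else
      ∏ k ∈ (children G r j).attach, Matrix.mulVec (A j k) (g k k.2)
  refine ⟨φ, fun j hj hjr => by rw [hφ, if_pos ⟨hj, hjr⟩], fun j hj => ?_⟩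
  rw [hφ, if_neg (by tauto)]
  exact prod_attach (children G r j) fun k => Matrix.mulVec (A j k) (φ k)

lemma exists_forward (v φ : V → Fin n → ℝ) : ∃ ψ : V → Fin n → ℝ, ψ r = 1 / v r ∧
    ∀ k, k ≠ r → ψ k =
      Matrix.mulVec (A (p k) k).transpose (ψ (p k) * phiWithout A φ (p k) k) := by
  obtain ⟨ψ, hψ⟩ := exists_fix (β := Fin n → ℝ) H.wellFounded_parent fun k g =>
    if hk : k = r then 1 / v r else
      Matrix.mulVec (A (p k) k).transpose (g (p k) ⟨hk, rfl⟩ * phiWithout A φ (p k) k)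
  exact ⟨ψ, by rw [hψ, dif_pos rfl], fun k hk => by rw [hψ, dif_neg hk]⟩

section Factors
variable {v φ ψ : V → Fin n → ℝ} (hv : ∀ j ∈ leaves G, ∀ i, 0 < v j i)
  (hφ₁ : ∀ j ∈ leaves G, j ≠ r → φ j = v j)
  (hφ₂ : ∀ j, j ∉ leaves G ∨ j = r → φ j = ∏ k ∈ children G r j, Matrix.mulVec (A j k) (φ k))
  (hψ₁ : ψ r = 1 / v r)
  (hψ₂ : ∀ k, k ≠ r → ψ k =
    Matrix.mulVec (A (p k) k).transpose (ψ (p k) * phiWithout A φ (p k) k))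
include hv hφ₁ hφ₂

lemma backward_pos (j : V) : ∀ i, 0 < φ j i := by
  induction j using H.wellFounded_child.induction with
  | _ j ih =>
    intro i
    by_cases hj : j ∈ leaves G ∧ j ≠ r
    · rw [hφ₁ j hj.1 hj.2]; exact hv j hj.1 i
    · rw [hφ₂ j (by tauto), Finset.prod_apply]
      refine prod_pos fun k hk => ?_
      obtain ⟨hkr, rfl⟩ := H.mem_children.1 hk
      exact mulVec_pos (H.pos k hkr) (ih k hk) i

lemma mulVec_backward_pos {k : V} (hk : k ≠ r) (a : Fin n) :
    0 < Matrix.mulVec (A (p k) k) (φ k) a :=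
  mulVec_pos (H.pos k hk) (H.backward_pos hv hφ₁ hφ₂ k) a

include hψ₁ hψ₂

lemma forward_pos (k : V) : ∀ i, 0 < ψ k i := by
  induction k using H.wellFounded_parent.induction with
  | _ k ih =>
    intro i
    by_cases hk : k = r
    · subst hk
      rw [hψ₁]
      exact div_pos one_pos (hv k H.root_mem i)
    · rw [hψ₂ k hk]
      refine mulVec_pos (fun a b => H.pos k hk b a) (fun b => ?_) i
      exact mul_pos (ih (p k) ⟨hk, rfl⟩ b) (div_pos (H.backward_pos hv hφ₁ hφ₂ (p k) b)
        (H.mulVec_backward_pos hv hφ₁ hφ₂ hk b))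

/-- The Markov tensor of a point factored through `φ` and `ψ` is the scaling of the Gibbs
tensor. -/
lemma bridgeTensor_eq {ν : V → Fin n → ℝ} {P : V → V → Matrix (Fin n) (Fin n) ℝ}
    (hν : ∀ j, ν j = φ j * ψ j)
    (hP : ∀ k, k ≠ r → P (p k) k = Matrix.diagonal (ψ (p k) * phiWithout A φ (p k) k) *
      A (p k) k * Matrix.diagonal (φ k)) :
    bridgeTensor p r A ν P = gibbs ε (treeCost G r C) * outer (bridgeScaling G r v) := by
  ext x
  have hφ := H.backward_pos hv hφ₁ hφ₂
  have hψ := H.forward_pos hv hφ₁ hφ₂ hψ₁ hψ₂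
  have hB := fun k (hk : k ≠ r) => H.mulVec_backward_pos hv hφ₁ hφ₂ hk
  have hT : ∀ k ∈ univ.erase r, transition p A ν P k (x (p k)) (x k) =
      A (p k) k (x (p k)) (x k) *
        (φ k (x k) / Matrix.mulVec (A (p k) k) (φ k) (x (p k))) := by
    intro k hk
    have hkr := ne_of_mem_erase hk
    have h1 := (hφ (p k) (x (p k))).ne'
    have h2 := (hψ (p k) (x (p k))).ne'
    have h3 := (hB k hkr (x (p k))).ne'
    rw [transition, hν, Pi.mul_apply, if_neg (mul_ne_zero h1 h2), hP k hkr, Matrix.mul_diagonal,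
      Matrix.diagonal_mul, phiWithout]
    simp only [Pi.mul_apply, Pi.div_apply]
    field_simp
  have hprod : ∏ k ∈ univ.erase r, Matrix.mulVec (A (p k) k) (φ k) (x (p k)) =
      ∏ j, ∏ k ∈ children G r j, Matrix.mulVec (A j k) (φ k) (x j) := by
    -- Edges are grouped by parent, to meet the recursion for `φ` at each vertex.
    rw [← prod_fiberwise (univ.erase r) p]
    refine prod_congr rfl fun j _ => ?_
    rw [H.children_eq j]
    exact prod_congr rfl fun k hk => by rw [(mem_filter.1 hk).2]
  -- At a leaf other than `r` the product over children is empty and the scaling vector is `φ j`; at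
  -- an inner vertex the product is `φ j`; at the root the scaling vector adds the factor `ψ r = 1 /
  -- v r`.
  have hfac : ∀ j, bridgeScaling G r v j (x j) *
      ∏ k ∈ children G r j, Matrix.mulVec (A j k) (φ k) (x j) =
        φ j (x j) * if j = r then ψ r (x r) else 1 := by
    intro j
    rw [← Finset.prod_apply, bridgeScaling]
    by_cases hjr : j = r
    · subst hjr
      rw [if_pos rfl, if_pos rfl, ← hφ₂ j (Or.inr rfl), hψ₁, mul_comm]
    · by_cases hj : j ∈ leaves G
      · simp [hjr, hj, H.children_leaf hj hjr, hφ₁ j hj hjr]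
      · rw [← hφ₂ j (Or.inl hj)]
        simp [hjr, hj]
  have hall : (∏ j, bridgeScaling G r v j (x j)) *
      ∏ k ∈ univ.erase r, Matrix.mulVec (A (p k) k) (φ k) (x (p k)) =
        φ r (x r) * (∏ k ∈ univ.erase r, φ k (x k)) * ψ r (x r) := by
    rw [hprod, ← prod_mul_distrib, prod_congr rfl fun j _ => hfac j, prod_mul_distrib,
      mul_prod_erase univ (fun k => φ k (x k)) (mem_univ r)]
    simp
  have hne : ∏ k ∈ univ.erase r, Matrix.mulVec (A (p k) k) (φ k) (x (p k)) ≠ 0 :=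
    prod_ne_zero_iff.2 fun k hk => (hB k (ne_of_mem_erase hk) _).ne'
  rw [bridgeTensor, markovTensor, prod_congr rfl hT, prod_mul_distrib, prod_div_distrib,
    Pi.mul_apply, H.gibbs_apply, outer, eq_div_of_mul_eq hne hall, hν, Pi.mul_apply]
  ring

/-- A point factored through `φ` and `ψ` has consistent marginals. -/
lemma sbFeasible_factors {ν : V → Fin n → ℝ} {P : V → V → Matrix (Fin n) (Fin n) ℝ}
    (hν : ∀ j, ν j = φ j * ψ j)
    (hP : ∀ k, k ≠ r → P (p k) k = Matrix.diagonal (ψ (p k) * phiWithout A φ (p k) k) *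
      A (p k) k * Matrix.diagonal (φ k)) : SBFeasible G r ν ν P := by
  have hφ := H.backward_pos hv hφ₁ hφ₂
  have hψ := H.forward_pos hv hφ₁ hφ₂ hψ₁ hψ₂
  have hB := fun k (hk : k ≠ r) => H.mulVec_backward_pos hv hφ₁ hφ₂ hk
  refine (sbFeasible_iff H.edges).2 ⟨fun _ _ => rfl, fun k hk => ?_⟩
  have hPk : ∀ a b, P (p k) k a b =
      (ψ (p k) * phiWithout A φ (p k) k) a * A (p k) k a b * φ k b := fun a b => by
    rw [hP k hk, Matrix.mul_diagonal, Matrix.diagonal_mul]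
  refine ⟨fun a b => ?_, fun a => ?_, fun b => ?_⟩
  · rw [hPk]
    exact (mul_pos (mul_pos (mul_pos (hψ _ _) (div_pos (hφ _ _) (hB k hk _)))
      (H.pos k hk _ _)) (hφ _ _)).le
  · simp only [hPk, mul_assoc]
    rw [← mul_sum, hν]
    change _ * Matrix.mulVec (A (p k) k) (φ k) a = _
    have := (hB k hk a).ne'
    simp only [phiWithout, Pi.mul_apply, Pi.div_apply]
    field_simp
  · simp only [hPk]
    rw [← sum_mul, hν, mul_comm, Pi.mul_apply, hψ₂ k hk]
    congr 1
    exact sum_congr rfl fun a _ => mul_comm _ _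

end Factors

lemma bridgeScaling_pos {v : V → Fin n → ℝ} (hv : ∀ j ∈ leaves G, ∀ i, 0 < v j i) (j : V)
    (i : Fin n) : 0 < bridgeScaling G r v j i := by
  rw [bridgeScaling]
  split_ifs with h1 h2
  · exact div_pos one_pos (hv r H.root_mem i)
  · exact hv j h2 i
  · exact one_pos

/-- Vectors represent the solution of the bridge problem if and only if they yield scaling vectors
of the solution of the transport problem. -/
lemma isSBFactorization_iff {M : Tensor V n}
    (hM : IsOTSolution ε (treeCost G r C) (leaves G) μ M) {ν : V → Fin n → ℝ}
    {P : V → V → Matrix (Fin n) (Fin n) ℝ} (h : IsSBSolution G r A μ ν P)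
    {v : V → Fin n → ℝ} (hv : ∀ j ∈ leaves G, ∀ i, 0 < v j i) :
    IsSBFactorization G r A ν P v ↔
      IsScaling (gibbs ε (treeCost G r C)) (leaves G) M (bridgeScaling G r v) := by
  constructor
  · rintro ⟨-, φ, ψ, hφ₁, hφ₂, hψ₁, hψ₂, hν, hP⟩
    rw [forall_mem_rootedEdges H.edges (Φ := fun j k => ψ k =
      Matrix.mulVec (A j k).transpose (ψ j * phiWithout A φ j k))] at hψ₂
    rw [forall_mem_rootedEdges H.edges (Φ := fun j k => P j k =
      Matrix.diagonal (ψ j * phiWithout A φ j k) * A j k * Matrix.diagonal (φ k))] at hP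
    refine ⟨H.bridgeScaling_pos hv, fun j hj => ?_, ?_⟩
    · rw [bridgeScaling, if_neg (ne_of_mem_of_not_mem H.root_mem hj).symm, if_neg hj]
    · rw [hM.unique H.eps_pos (H.isOTSolution_bridgeTensor h)]
      exact H.bridgeTensor_eq hv hφ₁ hφ₂ hψ₁ hψ₂ hν hP
  · rintro ⟨-, -, hMeq⟩
    obtain ⟨φ, hφ₁, hφ₂⟩ := H.exists_backward v
    obtain ⟨ψ, hψ₁, hψ₂⟩ := H.exists_forward v φ
    set ν' : V → Fin n → ℝ := fun j => φ j * ψ j with hν'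
    set P' : V → V → Matrix (Fin n) (Fin n) ℝ := fun j k =>
      Matrix.diagonal (ψ j * phiWithout A φ j k) * A j k * Matrix.diagonal (φ k) with hP'
    have hM' : bridgeTensor p r A ν' P' = M :=
      (H.bridgeTensor_eq hv hφ₁ hφ₂ hψ₁ hψ₂ (fun _ => rfl) fun _ _ => rfl).trans hMeq.symm
    -- The factored point is taken as feasible for its own leaf marginals, as agreement with `μ` is
    -- not yet known. Its chain is `M`, so it has the marginals of `M`, which are those of the
    -- bridge solution.
    obtain ⟨h1, h2⟩ := bridgeTensor_marginals H.edges H.row_sum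
      (H.sbFeasible_factors hv hφ₁ hφ₂ hψ₁ hψ₂ (ν := ν') (P := P') (fun _ => rfl)
        fun _ _ => rfl) H.parent_lt
    rw [hM'] at h1 h2
    obtain ⟨h3, h4⟩ := (H.isSBSolution_iff hM).1 h
    refine ⟨hv, φ, ψ, hφ₁, hφ₂, hψ₁, ?_, fun j => (h3 j).symm.trans (h1 j), ?_⟩
    · exact (forall_mem_rootedEdges H.edges (Φ := fun j k => ψ k =
        Matrix.mulVec (A j k).transpose (ψ j * phiWithout A φ j k))).2 hψ₂
    · intro e he
      rw [← h4 e he]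
      exact (forall_mem_rootedEdges H.edges (Φ := fun j k => bimarginal M j k = P' j k)).2 h2 e he

end BridgeData

end Factorization

end TreeOT

theorem mainTheorem1 {V : Type*} [Fintype V] [DecidableEq V] {n : ℕ}
    (G : SimpleGraph V) [DecidableRel G.Adj] (hG : G.IsTree)
    (r : V) (hr : r ∈ TreeOT.leaves G)
    (μ : V → Fin n → ℝ)
    (hμ : ∀ j ∈ TreeOT.leaves G, ∀ i, 0 ≤ μ j i)
    (hmass : ∀ j ∈ TreeOT.leaves G, ∀ k ∈ TreeOT.leaves G, ∑ i, μ j i = ∑ i, μ k i)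
    (A C : V → V → Matrix (Fin n) (Fin n) ℝ)
    (hA_pos : ∀ e ∈ TreeOT.rootedEdges G r, ∀ a b, 0 < A e.1 e.2 a b)
    (hA_row : ∀ e ∈ TreeOT.rootedEdges G r, ∀ a, ∑ b, A e.1 e.2 a b = 1)
    (ε : ℝ) (hε : 0 < ε)
    (hKA : ∀ e ∈ TreeOT.rootedEdges G r, ∀ a b,
      Real.exp (-C e.1 e.2 a b / ε) = A e.1 e.2 a b) :
    -- the transport problem has exactly one solution
    (∃! M : TreeOT.Tensor V n,
      TreeOT.IsOTSolution ε (TreeOT.treeCost G r C) (TreeOT.leaves G) μ M) ∧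
    ∀ M : TreeOT.Tensor V n,
      TreeOT.IsOTSolution ε (TreeOT.treeCost G r C) (TreeOT.leaves G) μ M →
      -- its marginals and edge bi-marginals are the one solution of the bridge problem
      (∀ (ν : V → Fin n → ℝ) (P : V → V → Matrix (Fin n) (Fin n) ℝ),
        TreeOT.IsSBSolution G r A μ ν P ↔
          (∀ j, TreeOT.marginal M j = ν j) ∧
          ∀ e ∈ TreeOT.rootedEdges G r, TreeOT.bimarginal M e.1 e.2 = P e.1 e.2) ∧
      -- for positive given marginals there are scaling vectors
      ((∀ j ∈ TreeOT.leaves G, ∀ i, 0 < μ j i) →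
        ∃ u : V → Fin n → ℝ,
          TreeOT.IsScaling (TreeOT.gibbs ε (TreeOT.treeCost G r C)) (TreeOT.leaves G) M u) ∧
      ∀ (ν : V → Fin n → ℝ) (P : V → V → Matrix (Fin n) (Fin n) ℝ),
        TreeOT.IsSBSolution G r A μ ν P →
        ∀ v : V → Fin n → ℝ, (∀ j ∈ TreeOT.leaves G, ∀ i, 0 < v j i) →
          -- `v` represents the bridge solution iff `1 ./ v_r`, `v_j` are scaling vectors of `M`
          (TreeOT.IsSBFactorization G r A ν P v ↔
            TreeOT.IsScaling (TreeOT.gibbs ε (TreeOT.treeCost G r C)) (TreeOT.leaves G) M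
              (TreeOT.bridgeScaling G r v)) ∧
          -- all scaling vectors of `M` are these, up to constants with product one
          (TreeOT.IsSBFactorization G r A ν P v →
            ∀ u : V → Fin n → ℝ,
              TreeOT.IsScaling (TreeOT.gibbs ε (TreeOT.treeCost G r C)) (TreeOT.leaves G) M u →
              ∃ c : V → ℝ, (∀ j, 0 < c j) ∧ (∏ j ∈ TreeOT.leaves G, c j = 1) ∧
                u r = c r • (1 / v r) ∧
                ∀ j ∈ TreeOT.leaves G, j ≠ r → u j = c j • v j) := by
  obtain ⟨p, d, hd, hE⟩ := TreeOT.exists_parent hG r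
  have H : TreeOT.BridgeData G r p d μ A C ε :=
    { parent_lt := hd
      edges := hE
      root_mem := hr
      nonneg := hμ
      pos := (TreeOT.forall_mem_rootedEdges hE (Φ := fun j k => ∀ a b, 0 < A j k a b)).1 hA_pos
      row_sum := (TreeOT.forall_mem_rootedEdges hE
        (Φ := fun j k => ∀ a, ∑ b, A j k a b = 1)).1 hA_row
      eps_pos := hε
      exp_eq := (TreeOT.forall_mem_rootedEdges hE
        (Φ := fun j k => ∀ a b, Real.exp (-C j k a b / ε) = A j k a b)).1 hKA }
  obtain ⟨M₀, hM₀⟩ := TreeOT.exists_isOTSolution ε (TreeOT.treeCost G r C) ⟨r, hr⟩ hμ hmass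
  refine ⟨⟨M₀, hM₀, fun M hM => hM.unique hε hM₀⟩, fun M hM =>
    ⟨fun ν P => H.isSBSolution_iff hM, fun hpos => hM.exists_isScaling hε ⟨r, hr⟩ hpos hmass,
      fun ν P hsol v hv => ⟨H.isSBFactorization_iff hM hsol hv, fun hfac u hu => ?_⟩⟩⟩
  have hw := (H.isSBFactorization_iff hM hsol hv).1 hfac
  -- The family built from `v` is itself a scaling, so any other differs from it by constants.
  obtain ⟨c, hc, hc1, huc⟩ := hu.eq_smul (fun x => (Real.exp_pos _).ne') hw
  refine ⟨c, hc, hc1, ?_, fun j hj hjr => ?_⟩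
  · rw [huc, TreeOT.bridgeScaling, if_pos rfl]
  · rw [huc, TreeOT.bridgeScaling, if_neg hjr, if_pos hj]
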